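/- Let $G$ be a locally compact group. **Definitions.** An object is a pair $(A,\alpha)$ of a $C^*$-algebra $A$ and a strongly continuous action $\alpha$ of $G$ on $A$ by $*$-automorphisms. A *right-Hilbert $A$–$B$ bimodule* ${}_AX_B$ is a Hilbert $B$-module $X$ (complete in $\|x\|=\|\langle x,x\rangle_B\|^{1/2}$) which is full (the closed linear span of $\langle X,X\rangle_B$ is $B$), together with a nondegenerate left $A$-module structure (the closed linear span of $A\cdot X$ is $X$) such that $a\cdot(x\cdot b)=(a\cdot x)\cdot b$ and $\langle a\cdot x,y\rangle_B=\langle x,a^*\cdot y\rangle_B$. For objects $(A,\alpha)$, $(B,\beta)$, an *$(\alpha,\beta)$-compatible action* $\gamma$ of $G$ on $X$ is a homomorphism of $G$ into the invertible linear transformations of $X$ such that $s\mapsto\gamma_s(x)$ is continuous for each $x$, and $\gamma_s(a\cdot x)=\alpha_s(a)\cdot\gamma_s(x)$, $\gamma_s(x\cdot b)=\gamma_s(x)\cdot\beta_s(b)$ and $\langle\gamma_s(x),\gamma_s(y)\rangle_B=\beta_s(\langle x,y\rangle_B)$. An *equivariant isomorphism* $(X,\gamma)\to(Y,\eta)$ is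 a linear bijection which preserves both module actions and the $B$-valued inner product and intertwines $\gamma$ and $\eta$; $[X,\gamma]$ denotes the equivariant isomorphism class. The *balanced tensor product* $(X\otimes_BY,\gamma\otimes_B\eta)$ of $({}_AX_B,\gamma)$ and $({}_BY_C,\eta)$ is the completion of the algebraic tensor product $X\odot Y$, modulo vectors of length $0$, for the inner product $\langle x\otimes y,z\otimes w\rangle_C=\langle y,\langle x,z\rangle_B\cdot w\rangle_C$, with $a\cdot(x\otimes y)=(a\cdot x)\otimes y$, $(x\otimes y)\cdot c=x\otimes(y\cdot c)$ and action $\gamma_s\otimes\eta_s$. An *imprimitivity bimodule* is a right-Hilbert bimodule ${}_AX_B$ which is also a full left Hilbert $A$-module, with an inner product ${}_A\langle\cdot,\cdot\rangle$ satisfying ${}_A\langle x,y\rangle\cdot z=x\cdot\langle y,z\rangle_B$ and ${}_A\langle x\cdot b,y\rangle={}_A\langle x,y\cdot b^*\rangle$. A homomorphism ($*$-homomorphism) $\phi:A\to M(C)$ into the multiplier algebra is *nondegenerate* if the closed linear span of $\phi(A)C$ is $C$, and, for an action $\epsilon$ of $G$ on $C$, it is *$\alpha$–$\epsilon$ equivariant*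 if $\phi(\alpha_s(a))=\epsilon_s(\phi(a))$, where $\epsilon_s$ is extended canonically to $M(C)$; then $[\phi,\epsilon]$ is the class of the bimodule ${}_AC_C$ with $a\cdot c=\phi(a)c$, $c\cdot d=cd$, $\langle c,d\rangle_C=c^*d$ and the action $\epsilon$. **Proposition.** (i) There is a category $\mathcal A(G)$ in which the objects are $C^*$-algebras with actions of $G$, and in which the morphisms from $(A,\alpha)$ to $(B,\beta)$ are the equivariant isomorphism classes of (full) right-Hilbert $A$–$B$ bimodules with $(\alpha,\beta)$-compatible actions of $G$. Balanced tensor products exist: $(X\otimes_BY,\gamma\otimes_B\eta)$ is again a right-Hilbert bimodule with a compatible action. The composition of $[X,\gamma]:(A,\alpha)\to(B,\beta)$ with $[Y,\eta]:(B,\beta)\to(C,\epsilon)$ is $[X\otimes_BY,\gamma\otimes_B\eta]$, and the identity morphism on $(A,\alpha)$ is the class of $A$ with $a\cdot b\cdot c=abc$, $\langle a,b\rangle_A=a^*b$ and the action $\alpha$. (ii) $[X,\gamma]:(A,\alpha)\to(B,\beta)$ is an isomorphism in $\mathcal A(G)$ if and only if ${}_AX_B$ is an imprimitivity bimodule and $\alpha_s({}_A\langle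 x,y\rangle)={}_A\langle\gamma_s(x),\gamma_s(y)\rangle$ for all $s\in G$ and $x,y\in X$. (iii) For every morphism $[X,\gamma]:(A,\alpha)\to(B,\beta)$ in $\mathcal A(G)$ there exist an object $(C,\epsilon)$, an isomorphism $[Y,\eta]:(C,\epsilon)\to(B,\beta)$ in $\mathcal A(G)$ and an $\alpha$–$\epsilon$ equivariant nondegenerate homomorphism $\phi:A\to M(C)$ such that $[X,\gamma]=[Y,\eta]\circ[\phi,\epsilon]$ in $\mathcal A(G)$. -/

import Mathlib

open CategoryTheory
open scoped TensorProduct MultiplierAlgebra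

universe u v

/-- A C*-dynamical system `(A, α)` over the topological group `G`: a (not necessarily unital)
C*-algebra `A` with a strongly continuous action `α` of `G` by `*`-automorphisms. -/
structure CStarSystem (G : Type v) [Group G] [TopologicalSpace G] where
  /-- the C*-algebra -/
  alg : Type u
  [cstar : NonUnitalCStarAlgebra alg]
  /-- the action `α` of `G` -/
  act : G →* (alg ≃⋆ₐ[ℂ] alg)
  continuous_act : ∀ a : alg, Continuous fun s : G => act s a

attribute [instance] CStarSystem.cstar

/-- A (full) right-Hilbert `A`-`B` bimodule. The right action `x · b` is `rsmul x b`, the left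
action `a · x` is `lsmul a x`, and the `B`-valued inner product `⟨x, y⟩` is `rip x y`, conjugate
linear in `x` and linear in `y`. An element of a C*-algebra is positive when it has the
form `b* b`. The completeness and the definiteness of the inner product refer to the norm of
`carrier`, which is `‖⟨x, x⟩‖ ^ (1 / 2)` by `norm_sq`. -/
structure RightHilbertBimodule (A B : Type u) [NonUnitalCStarAlgebra A]
    [NonUnitalCStarAlgebra B] where
  /-- the underlying Banach space -/
  carrier : Type u
  [normed : NormedAddCommGroup carrier]
  [space : NormedSpace ℂ carrier]
  [complete : CompleteSpace carrier]
  /-- the right action of `B` -/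
  rsmul : carrier →ₗ[ℂ] B →ₗ[ℂ] carrier
  /-- the left action of `A` -/
  lsmul : A →ₗ[ℂ] carrier →ₗ[ℂ] carrier
  /-- the inner product with values in `B` -/
  rip : carrier →ₗ⋆[ℂ] carrier →ₗ[ℂ] B
  rsmul_mul : ∀ x b c, rsmul x (b * c) = rsmul (rsmul x b) c
  rip_rsmul : ∀ x y b, rip x (rsmul y b) = rip x y * b
  star_rip : ∀ x y, star (rip x y) = rip y x
  rip_self_nonneg : ∀ x, ∃ b, rip x x = star b * b
  norm_sq : ∀ x, ‖x‖ ^ 2 = ‖rip x x‖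
  /-- `X` is full as a Hilbert `B`-module -/
  full : Dense (Submodule.span ℂ {b : B | ∃ x y, rip x y = b} : Set B)
  mul_lsmul : ∀ a a' x, lsmul (a * a') x = lsmul a (lsmul a' x)
  lsmul_rsmul : ∀ a x b, lsmul a (rsmul x b) = rsmul (lsmul a x) b
  rip_lsmul : ∀ a x y, rip (lsmul a x) y = rip x (lsmul (star a) y)
  /-- the left `A`-module `X` is nondegenerate -/
  nondegenerate : Dense (Submodule.span ℂ {z : carrier | ∃ a x, lsmul a x = z} : Set carrier)

attribute [instance] RightHilbertBimodule.normed RightHilbertBimodule.space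
  RightHilbertBimodule.complete

section

variable {G : Type v} [Group G] [TopologicalSpace G]

/-- A right-Hilbert `A`-`B` bimodule `X` with an `(α, β)`-compatible (strongly continuous) action
`γ` of `G`. -/
structure EquivariantBimodule (A B : CStarSystem.{u} G) extends
    RightHilbertBimodule A.alg B.alg where
  /-- the action `γ` of `G` on `X` -/
  act : G →* (carrier ≃ₗ[ℂ] carrier)
  act_lsmul : ∀ s a x, act s (lsmul a x) = lsmul (A.act s a) (act s x)
  act_rsmul : ∀ s x b, act s (rsmul x b) = rsmul (act s x) (B.act s b)
  rip_act : ∀ s x y, rip (act s x) (act s y) = B.act s (rip x y)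
  continuous_act : ∀ x, Continuous fun s : G => act s x

namespace EquivariantBimodule

variable {A B C : CStarSystem.{u} G}

/-- Equivariant isomorphism of right-Hilbert bimodules with compatible actions. -/
def Isomorphic (X Y : EquivariantBimodule A B) : Prop :=
  ∃ Φ : X.carrier ≃ₗ[ℂ] Y.carrier,
    (∀ a x, Φ (X.lsmul a x) = Y.lsmul a (Φ x)) ∧
    (∀ x b, Φ (X.rsmul x b) = Y.rsmul (Φ x) b) ∧
    (∀ x y, Y.rip (Φ x) (Φ y) = X.rip x y) ∧
    (∀ s x, Φ (X.act s x) = Y.act s (Φ x))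

instance setoid (A B : CStarSystem.{u} G) : Setoid (EquivariantBimodule A B) where
  r := Isomorphic
  iseqv :=
    { refl := fun X => ⟨LinearEquiv.refl ℂ _, by simp⟩
      symm := by
        rintro X Y ⟨Φ, h1, h2, h3, h4⟩
        refine ⟨Φ.symm, fun a x => ?_, fun x b => ?_, fun x y => ?_, fun s x => ?_⟩
        · apply Φ.injective; simp [h1]
        · apply Φ.injective; simp [h2]
        · rw [← h3]; simp
        · apply Φ.injective; simp [h4]
      trans := by
        rintro X Y Z ⟨Φ, h1, h2, h3, h4⟩ ⟨Ψ, k1, k2, k3, k4⟩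
        exact ⟨Φ.trans Ψ, by simp [h1, k1], by simp [h2, k2], by simp [h3, k3],
          by simp [h4, k4]⟩ }

/-- `Z` is the balanced (internal) tensor product `(X ⊗_B Y, γ ⊗_B η)`, that is, the completion
of the algebraic tensor product of `X` and `Y`, modulo the vectors of length zero, for the
inner product `⟨x ⊗ y, z ⊗ w⟩ = ⟨y, ⟨x, z⟩ · w⟩`, with the actions
`a · (x ⊗ y) = (a · x) ⊗ y`, `(x ⊗ y) · c = x ⊗ (y · c)` and `s ↦ γ_s ⊗ η_s`. The map `q` is the
canonical map of the algebraic tensor product into its completion. -/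
def IsBalancedTensor (X : EquivariantBimodule A B) (Y : EquivariantBimodule B C)
    (Z : EquivariantBimodule A C) : Prop :=
  ∃ q : X.carrier ⊗[ℂ] Y.carrier →ₗ[ℂ] Z.carrier,
    DenseRange q ∧
    (∀ x y z w, Z.rip (q (x ⊗ₜ y)) (q (z ⊗ₜ w)) = Y.rip y (Y.lsmul (X.rip x z) w)) ∧
    (∀ a x y, Z.lsmul a (q (x ⊗ₜ y)) = q (X.lsmul a x ⊗ₜ y)) ∧
    (∀ x y c, Z.rsmul (q (x ⊗ₜ y)) c = q (x ⊗ₜ Y.rsmul y c)) ∧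
    (∀ s x y, Z.act s (q (x ⊗ₜ y)) = q (X.act s x ⊗ₜ Y.act s y))

/-- `lip` is an `A`-valued inner product on `X`, linear in the first and conjugate linear in the
second variable, which makes the left `A`-module `X` a full left Hilbert `A`-module. -/
structure IsFullLeftHilbert (X : EquivariantBimodule A B)
    (lip : X.carrier → X.carrier → A.alg) : Prop where
  add_left : ∀ x y z, lip (x + y) z = lip x z + lip y z
  smul_left : ∀ (c : ℂ) x y, lip (c • x) y = c • lip x y
  lsmul_left : ∀ a x y, lip (X.lsmul a x) y = a * lip x y
  star_lip : ∀ x y, star (lip x y) = lip y x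
  self_nonneg : ∀ x, ∃ a, lip x x = star a * a
  definite : ∀ x, lip x x = 0 → x = 0
  /-- `X` is complete in the norm `‖lip x x‖ ^ (1 / 2)` -/
  complete : ∀ f : ℕ → X.carrier,
    (∀ ε > 0, ∃ N, ∀ m ≥ N, ∀ n ≥ N, √‖lip (f m - f n) (f m - f n)‖ < ε) →
    ∃ x, ∀ ε > 0, ∃ N, ∀ n ≥ N, √‖lip (f n - x) (f n - x)‖ < ε
  full : Dense (Submodule.span ℂ {a : A.alg | ∃ x y, lip x y = a} : Set A.alg)

/-- `X` is an equivariant `A`-`B` imprimitivity bimodule: it is an imprimitivity bimodule whose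
left inner product satisfies `α_s(⟨x, y⟩) = ⟨γ_s(x), γ_s(y)⟩`. -/
def IsEquivariantImprimitivity (X : EquivariantBimodule A B) : Prop :=
  ∃ lip : X.carrier → X.carrier → A.alg,
    X.IsFullLeftHilbert lip ∧
    (∀ x y z, X.lsmul (lip x y) z = X.rsmul x (X.rip y z)) ∧
    (∀ x b y, lip (X.rsmul x b) y = lip x (X.rsmul y (star b))) ∧
    (∀ s x y, A.act s (lip x y) = lip (X.act s x) (X.act s y))

end EquivariantBimodule

/-- The morphisms from `(A, α)` to `(B, β)`: equivariant isomorphism classes of right-Hilbert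
`A`-`B` bimodules with compatible actions. -/
def BimoduleClass (A B : CStarSystem.{u} G) : Type (max (u + 1) v) :=
  Quotient (EquivariantBimodule.setoid A B)

/-- The class `[X, γ]`. -/
def EquivariantBimodule.cls {A B : CStarSystem.{u} G} (X : EquivariantBimodule A B) :
    BimoduleClass A B :=
  Quotient.mk _ X

theorem CStarSystem.dense_span_mul (D : Type u) [NonUnitalCStarAlgebra D] :
    Dense (Submodule.span ℂ {d : D | ∃ a b : D, a * b = d} : Set D) := by
  let _ := CStarAlgebra.spectralOrder D
  have _ := CStarAlgebra.spectralOrderedRing D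
  intro d
  have h := (CStarAlgebra.increasingApproximateUnit D)
  have := h.neBot
  exact mem_closure_of_tendsto (h.tendsto_mul_left d)
    (Filter.Eventually.of_forall fun e => Submodule.subset_span ⟨_, _, rfl⟩)

theorem CStarSystem.dense_span_star_mul (D : Type u) [NonUnitalCStarAlgebra D] :
    Dense (Submodule.span ℂ {d : D | ∃ a b : D, star a * b = d} : Set D) := by
  have : {d : D | ∃ a b : D, star a * b = d} = {d : D | ∃ a b : D, a * b = d} := by
    ext d
    exact ⟨fun ⟨a, b, h⟩ => ⟨star a, b, h⟩, fun ⟨a, b, h⟩ => ⟨star a, b, by simpa using h⟩⟩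
  rw [this]
  exact CStarSystem.dense_span_mul D

/-- The automorphism `α_s` of `A` as a linear equivalence. -/
def CStarSystem.actE (A : CStarSystem.{u} G) (s : G) : A.alg ≃ₗ[ℂ] A.alg :=
  { (A.act s).toEquiv with
    map_add' := map_add (A.act s)
    map_smul' := map_smul (A.act s) }

@[simp]
theorem CStarSystem.actE_apply (A : CStarSystem.{u} G) (s : G) (a : A.alg) :
    A.actE s a = A.act s a := rfl

/-- The identity bimodule: `A` with `a · b · c = abc`, `⟨a, b⟩ = a* b` and the action `α`. -/
noncomputable def CStarSystem.idBimodule (A : CStarSystem.{u} G) : EquivariantBimodule A A where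
  carrier := A.alg
  rsmul := LinearMap.mul ℂ A.alg
  lsmul := LinearMap.mul ℂ A.alg
  rip := LinearMap.mk₂'ₛₗ (starRingEnd ℂ) (RingHom.id ℂ) (fun a b => star a * b)
    (by simp [add_mul]) (by simp [smul_mul_assoc]) (by simp [mul_add])
    (by simp [mul_smul_comm])
  rsmul_mul := by simp [mul_assoc]
  rip_rsmul := by simp [mul_assoc]
  star_rip := by simp
  rip_self_nonneg x := ⟨x, rfl⟩
  norm_sq x := by simp [CStarRing.norm_star_mul_self, sq]
  full := CStarSystem.dense_span_star_mul A.alg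
  mul_lsmul := by simp [mul_assoc]
  lsmul_rsmul := by simp [mul_assoc]
  rip_lsmul := by simp [mul_assoc]
  nondegenerate := CStarSystem.dense_span_mul A.alg
  act :=
    { toFun := A.actE
      map_one' := by ext; simp
      map_mul' := fun s t => by ext; simp }
  act_lsmul := by simp
  act_rsmul := by simp
  rip_act := by simp [map_star]
  continuous_act := A.continuous_act

/-- The automorphism `α_s` of `A` as a continuous linear map. -/
noncomputable def CStarSystem.actL (A : CStarSystem.{u} G) (s : G) : A.alg →L[ℂ] A.alg :=
  ⟨(A.actE s).toLinearMap,
    (NonUnitalStarAlgHom.isometry (A.act s) (A.act s).injective).continuous⟩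

/-- The canonical extension of `α_s` to the multiplier algebra `M(A)`:
`m ↦ α_s ∘ m ∘ α_s⁻¹`. -/
noncomputable def CStarSystem.multAct (A : CStarSystem.{u} G) (s : G) (m : 𝓜(ℂ, A.alg)) :
    𝓜(ℂ, A.alg) where
  fst := A.actL s ∘L m.fst ∘L A.actL s⁻¹
  snd := A.actL s ∘L m.snd ∘L A.actL s⁻¹
  central x y := by
    have key : ∀ z : A.alg, A.act s (A.act s⁻¹ z) = z := fun z => by
      rw [← StarAlgEquiv.mul_apply, ← map_mul]; simp
    change A.act s (m.snd (A.act s⁻¹ x)) * y = x * A.act s (m.fst (A.act s⁻¹ y))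
    have h := congrArg (A.act s) (m.central (A.act s⁻¹ x) (A.act s⁻¹ y))
    rwa [map_mul, map_mul, key, key] at h

/-- An `α`-`β` equivariant nondegenerate homomorphism `φ : A → M(B)`. -/
structure EquivariantMultiplierHom (A B : CStarSystem.{u} G) where
  /-- the homomorphism -/
  hom : A.alg →⋆ₙₐ[ℂ] 𝓜(ℂ, B.alg)
  nondegenerate :
    Dense (Submodule.span ℂ {c : B.alg | ∃ a b, (hom a).fst b = c} : Set B.alg)
  equivariant : ∀ s a, hom (A.act s a) = B.multAct s (hom a)

theorem DoubleCentralizer.fst_mul_apply {D : Type u} [NonUnitalCStarAlgebra D] (m : 𝓜(ℂ, D))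
    (c d : D) : m.fst (c * d) = m.fst c * d := by
  have h : ∀ x : D, x * (m.fst (c * d) - m.fst c * d) = 0 := fun x => by
    rw [mul_sub, ← m.central, ← mul_assoc, ← mul_assoc, ← m.central, sub_self]
  have := h (star (m.fst (c * d) - m.fst c * d))
  rwa [CStarRing.star_mul_self_eq_zero_iff, sub_eq_zero] at this

/-- The bimodule of an equivariant nondegenerate homomorphism `φ : A → M(B)`: the Hilbert module
`B_B` with the left action `a · b = φ(a) b` and the action `β`. Its class is `[φ, β]`. -/
noncomputable def EquivariantMultiplierHom.bimodule {A B : CStarSystem.{u} G}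
    (φ : EquivariantMultiplierHom A B) : EquivariantBimodule A B where
  carrier := B.alg
  rsmul := LinearMap.mul ℂ B.alg
  lsmul := LinearMap.mk₂ ℂ (fun a b => (φ.hom a).fst b) (by simp) (by simp) (by simp) (by simp)
  rip := B.idBimodule.rip
  rsmul_mul := by simp [mul_assoc]
  rip_rsmul := B.idBimodule.rip_rsmul
  star_rip := B.idBimodule.star_rip
  rip_self_nonneg := B.idBimodule.rip_self_nonneg
  norm_sq := B.idBimodule.norm_sq
  full := B.idBimodule.full
  mul_lsmul := by simp
  lsmul_rsmul a x b := DoubleCentralizer.fst_mul_apply _ _ _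
  rip_lsmul a x y := by
    change star ((φ.hom a).fst x) * y = star x * (φ.hom (star a)).fst y
    rw [map_star, DoubleCentralizer.star_fst, ← star_mul, (φ.hom a).central, star_mul, star_star]
  nondegenerate := φ.nondegenerate
  act := B.idBimodule.act
  act_lsmul s a x := by
    change B.act s ((φ.hom a).fst x) = (φ.hom (A.act s a)).fst (B.act s x)
    rw [φ.equivariant]
    change _ = B.act s ((φ.hom a).fst (B.act s⁻¹ (B.act s x)))
    rw [← StarAlgEquiv.mul_apply (B.act s⁻¹), ← map_mul]
    simp
  act_rsmul := B.idBimodule.act_rsmul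
  rip_act := B.idBimodule.rip_act
  continuous_act := B.continuous_act

end

/-!
All constructions take place on an algebraic level, with a positive semidefinite inner product,
and are then completed. Two general facts carry most of the argument.

* `PreHilbertBimodule.exists_completion`: a bimodule with a semidefinite inner product (a
  `PreHilbertBimodule`) and a compatible action of `G` completes to a right-Hilbert bimodule. The
  Cauchy–Schwarz inequality and the automatic contractivity of `*`-representations make all the
  operations continuous.
* `EquivariantBimodule.isomorphic_of_denseRange`: two bimodules which contain images of one vector
  space as dense subspaces, with the same inner products and the same actions, are isomorphic.

*Tensor products.* The inner product of `X ⊙ Y` is positive since Gram matrices over a C*-algebra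
factorize as `S* S` (`PreHilbertBimodule.exists_gram_eq`). The matrix algebra over `B` is a
C*-algebra, so a Gram matrix `M` can be compressed to its negative part `N`. Then `N* M N` is
negative, but its diagonal entries are inner squares, which forces it to vanish. The uniqueness of
balanced tensor products, the unit laws and associativity are instances of
`isomorphic_of_denseRange`.

*Isomorphisms.* The inverse of an imprimitivity bimodule is its dual, the completed conjugate space
with the left inner product; the two inner products identify `X ⊗ X~` with `A` and `X~ ⊗ X` with
`B`. Conversely let `X ⊗_B Y ≅ A` and `Y ⊗_A X ≅ B`. Then `A` and `B` act faithfully on `X` and `Y`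
(`isFaithful_of_isBalancedTensor_id`). For `a` in `A` of the form `(u ⊗ v)*`, the operator
`a θ_{x,x'}` on `X`, where `θ_{x,x'} z = x · ⟨x', z⟩`, is again given by an element of `A`. Since
`A · X` is total in `X`, the algebra `A` contains all the operators `θ_{x,x'}`, and these span a
dense subspace of `A` (`isEquivariantImprimitivity_of_isBalancedTensor_id`). So `A` is the algebra
of compact operators on `X`, and `(x, x') ↦ θ_{x,x'}` is the left inner product.

*Factorization.* Let `C` be the algebra of compact operators on `X`, with `G` acting by conjugation.
Then `X` is a `C`-`B` imprimitivity bimodule, `A` acts on `C` by multipliers, and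
`C ⊗_C X ≅ X`.
-/

/-! ### Positive elements of C*-algebras -/

namespace NonUnitalCStarAlgebra

variable {A : Type*} [NonUnitalCStarAlgebra A]

/-- `a` has the form `b* b`. This is positivity, without a choice of an order on `A`. -/
def IsPos (a : A) : Prop := ∃ b, a = star b * b

theorem isPos_iff_nonneg {a : A} :
    letI := CStarAlgebra.spectralOrder A
    IsPos a ↔ 0 ≤ a := by
  let := CStarAlgebra.spectralOrder A
  have := CStarAlgebra.spectralOrderedRing A
  exact CStarAlgebra.nonneg_iff_eq_star_mul_self.symm

theorem isPos_zero : IsPos (0 : A) := ⟨0, by simp⟩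

theorem IsPos.add {a b : A} (ha : IsPos a) (hb : IsPos b) : IsPos (a + b) := by
  let := CStarAlgebra.spectralOrder A
  have := CStarAlgebra.spectralOrderedRing A
  rw [isPos_iff_nonneg] at *
  exact add_nonneg ha hb

theorem IsPos.sum {ι : Type*} (s : Finset ι) {f : ι → A} (h : ∀ i ∈ s, IsPos (f i)) :
    IsPos (∑ i ∈ s, f i) :=
  Finset.sum_induction _ IsPos (fun _ _ => IsPos.add) isPos_zero h

theorem isClosed_isPos : IsClosed {a : A | IsPos a} := by
  let := CStarAlgebra.spectralOrder A
  have := CStarAlgebra.spectralOrderedRing A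
  simp only [isPos_iff_nonneg]
  exact CStarAlgebra.isClosed_nonneg

theorem IsPos.norm_le {a b : A} (ha : IsPos a) (hab : IsPos (b - a)) : ‖a‖ ≤ ‖b‖ := by
  let := CStarAlgebra.spectralOrder A
  have := CStarAlgebra.spectralOrderedRing A
  rw [isPos_iff_nonneg] at *
  exact CStarAlgebra.norm_le_norm_of_nonneg_of_le ha (sub_nonneg.1 hab)

theorem IsPos.smul {a : A} (ha : IsPos a) {r : ℝ} (hr : 0 ≤ r) : IsPos ((r : ℂ) • a) := by
  obtain ⟨b, rfl⟩ := ha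
  refine ⟨((√r : ℝ) : ℂ) • b, ?_⟩
  rw [star_smul, smul_mul_smul_comm]
  congr 1
  simp [← Complex.ofReal_mul, Real.mul_self_sqrt hr]

/-- Compressing a self-adjoint element `a` to its negative part yields a negative element,
which vanishes only if `a` is positive. -/
theorem exists_compression_neg {a : A} (ha : IsSelfAdjoint a) :
    ∃ n s : A, star n * a * n = -(star s * s) ∧ (s = 0 → IsPos a) := by
  let := CStarAlgebra.spectralOrder A
  have := CStarAlgebra.spectralOrderedRing A
  have hn : 0 ≤ a⁻ := CFC.negPart_nonneg a
  have hsa : star a⁻ = a⁻ := hn.isSelfAdjoint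
  obtain ⟨s, hs⟩ := CStarAlgebra.nonneg_iff_eq_star_mul_self.1
    (star_left_conjugate_nonneg hn a⁻)
  have h0 : a⁺ * a⁻ = 0 := CFC.posPart_mul_negPart a
  have hd : a⁺ - a⁻ = a := CFC.posPart_sub_negPart a
  refine ⟨a⁻, s, ?_, fun h => ?_⟩
  · rw [← hs]
    conv_lhs => enter [1, 2]; rw [← hd]
    rw [mul_sub, sub_mul, mul_assoc, h0]
    simp
  · rw [h, mul_zero, hsa] at hs
    have h2 : a⁻ * a⁻ = 0 := by
      rw [← CStarRing.star_mul_self_eq_zero_iff, star_mul, hsa, ← mul_assoc, hs, zero_mul]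
    have h1 : a⁻ = 0 := by
      rw [← CStarRing.star_mul_self_eq_zero_iff, hsa, h2]
    rw [isPos_iff_nonneg, ← hd, h1, sub_zero]
    exact CFC.posPart_nonneg a

/-- `‖a‖² - a* a` is `w* w` for an element `w = c + b` of the unitization of `A`. -/
theorem exists_norm_sq_sub_star_mul_self (a : A) :
    ∃ (c : ℂ) (b : A), star c * c = ((‖a‖ ^ 2 : ℝ) : ℂ) ∧
      star c • b + c • star b + star b * b = -(star a * a) := by
  let := CStarAlgebra.spectralOrder (Unitization ℂ A)
  have := CStarAlgebra.spectralOrderedRing (Unitization ℂ A)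
  have h := CStarAlgebra.star_mul_le_algebraMap_norm_sq (a := (a : Unitization ℂ A))
  obtain ⟨w, hw⟩ := CStarAlgebra.nonneg_iff_eq_star_mul_self.1 (sub_nonneg.2 h)
  rw [sub_eq_iff_eq_add] at hw
  refine ⟨w.fst, w.snd, ?_, ?_⟩
  · have := congrArg (fun z : Unitization ℂ A => z.fst) hw
    simpa [Unitization.algebraMap_eq_inl_comp, Unitization.norm_inr] using this.symm
  · have := congrArg (fun z : Unitization ℂ A => z.snd) hw
    simp only [Unitization.snd_mul, Unitization.fst_star, Unitization.snd_star,
      Unitization.snd_add] at this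
    rw [eq_neg_iff_add_eq_zero]
    simpa [Unitization.algebraMap_eq_inl_comp] using this.symm

end NonUnitalCStarAlgebra

open NonUnitalCStarAlgebra

/-! ### Pre-Hilbert bimodules -/

/-- The algebraic data of a right-Hilbert bimodule: a bimodule with a positive semidefinite inner
product, without a norm. The compatibilities of the module actions that a definite inner product
enforces are left out; they hold in the completion. -/
structure PreHilbertBimodule (A B : Type*) [NonUnitalCStarAlgebra A]
    [NonUnitalCStarAlgebra B] where
  /-- the underlying vector space -/
  carrier : Type u
  [addCommGroup : AddCommGroup carrier]
  [module : Module ℂ carrier]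
  /-- the right action of `B` -/
  rsmul : carrier →ₗ[ℂ] B →ₗ[ℂ] carrier
  /-- the left action of `A` -/
  lsmul : A →ₗ[ℂ] carrier →ₗ[ℂ] carrier
  /-- the inner product with values in `B` -/
  rip : carrier →ₗ⋆[ℂ] carrier →ₗ[ℂ] B
  rip_rsmul : ∀ x y b, rip x (rsmul y b) = rip x y * b
  star_rip : ∀ x y, star (rip x y) = rip y x
  isPos_rip_self : ∀ x, IsPos (rip x x)
  mul_lsmul : ∀ a a' x, lsmul (a * a') x = lsmul a (lsmul a' x)
  rip_lsmul : ∀ a x y, rip (lsmul a x) y = rip x (lsmul (star a) y)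

namespace PreHilbertBimodule

attribute [instance] PreHilbertBimodule.addCommGroup PreHilbertBimodule.module

variable {A B : Type*} [NonUnitalCStarAlgebra A] [NonUnitalCStarAlgebra B]
  (P : PreHilbertBimodule.{u} A B)

theorem rip_rsmul_left (x y : P.carrier) (b : B) : P.rip (P.rsmul x b) y = star b * P.rip x y := by
  rw [← P.star_rip, P.rip_rsmul, star_mul, P.star_rip]

/-- The Cauchy–Schwarz inequality. -/
theorem norm_rip_sq_le (x y : P.carrier) :
    ‖P.rip x y‖ ^ 2 ≤ ‖P.rip x x‖ * ‖P.rip y y‖ := by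
  set a := P.rip x y with ha
  -- The inner square of `t x · ⟨x, y⟩ - y` is positive, for all real `t`.
  have key : ∀ t : ℝ, 0 < t → (2 * t - t ^ 2 * ‖P.rip x x‖) * ‖a‖ ^ 2 ≤ ‖P.rip y y‖ := by
    intro t ht
    by_cases hneg : 2 * t - t ^ 2 * ‖P.rip x x‖ < 0
    · exact (mul_nonpos_of_nonpos_of_nonneg hneg.le (by positivity)).trans (norm_nonneg _)
    push Not at hneg
    let := CStarAlgebra.spectralOrder B
    have := CStarAlgebra.spectralOrderedRing B
    have h1 := isPos_iff_nonneg.1 (P.isPos_rip_self ((t : ℂ) • P.rsmul x a - y))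
    have hx : P.rip (P.rsmul x a) y = star a * a := by rw [rip_rsmul_left]
    have hy : P.rip y (P.rsmul x a) = star a * a := by
      rw [P.rip_rsmul, ← P.star_rip, ← ha]
    have h2 : P.rip ((t : ℂ) • P.rsmul x a - y) ((t : ℂ) • P.rsmul x a - y) =
        ((t ^ 2 : ℝ) : ℂ) • (star a * P.rip x x * a) - ((2 * t : ℝ) : ℂ) • (star a * a)
          + P.rip y y := by
      simp only [map_sub, LinearMap.sub_apply, map_smulₛₗ, LinearMap.smul_apply, hx, hy,
        RingHom.id_apply, Complex.conj_ofReal]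
      rw [P.rip_rsmul, rip_rsmul_left]
      push_cast
      module
    rw [h2] at h1
    have h3 : star a * P.rip x x * a ≤ ‖P.rip x x‖ • (star a * a) :=
      CStarAlgebra.star_left_conjugate_le_norm_smul
        (isPos_iff_nonneg.1 (P.isPos_rip_self x)).isSelfAdjoint
    have h3' := isPos_iff_nonneg.1 ((isPos_iff_nonneg.2 (sub_nonneg.2 h3)).smul (sq_nonneg t))
    have h4 : IsPos (P.rip y y -
        ((2 * t - t ^ 2 * ‖P.rip x x‖ : ℝ) : ℂ) • (star a * a)) := by
      rw [isPos_iff_nonneg]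
      have := add_nonneg h1 h3'
      convert this using 1
      rw [← Complex.coe_smul (‖P.rip x x‖)]
      push_cast
      module
    have h5 := IsPos.norm_le (IsPos.smul ⟨a, rfl⟩ hneg) h4
    rwa [norm_smul, CStarRing.norm_star_mul_self, Complex.norm_real, Real.norm_of_nonneg hneg,
      ← sq] at h5
  -- The best choice is `t = 1 / ‖⟨x, x⟩‖`; adding `ε` avoids a vanishing denominator.
  set N := ‖P.rip x x‖ with hN
  have hN0 : 0 ≤ N := norm_nonneg _
  have key2 : ∀ ε : ℝ, 0 < ε → ‖a‖ ^ 2 ≤ (N + ε) * ‖P.rip y y‖ := by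
    intro ε hε
    have h := key (N + ε)⁻¹ (by positivity)
    have h6 : (N + ε)⁻¹ ≤ 2 * (N + ε)⁻¹ - (N + ε)⁻¹ ^ 2 * N := by
      have : (N + ε)⁻¹ ^ 2 * N ≤ (N + ε)⁻¹ := by
        rw [sq, mul_assoc]
        refine mul_le_of_le_one_right (by positivity) ?_
        rw [inv_mul_le_iff₀ (by positivity)]
        linarith
      linarith
    have h7 := (mul_le_mul_of_nonneg_right h6 (sq_nonneg ‖a‖)).trans h
    rwa [inv_mul_le_iff₀ (by positivity)] at h7
  refine le_of_tendsto' (x := nhdsWithin (0 : ℝ) (Set.Ioi 0)) (f := fun _ => ‖a‖ ^ 2)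
    tendsto_const_nhds (fun _ => le_rfl) |>.trans ?_
  refine ge_of_tendsto (x := nhdsWithin (0 : ℝ) (Set.Ioi 0))
    (f := fun ε => (N + ε) * ‖P.rip y y‖) ?_ ?_
  · have : Filter.Tendsto (fun ε : ℝ => (N + ε) * ‖P.rip y y‖) (nhds 0)
        (nhds ((N + 0) * ‖P.rip y y‖)) := by
      apply Continuous.tendsto
      fun_prop
    rw [add_zero] at this
    exact this.mono_left nhdsWithin_le_nhds
  · filter_upwards [self_mem_nhdsWithin] with ε hε using key2 ε hε

/-- A `*`-representation by adjointable operators is automatically contractive. -/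
theorem norm_rip_lsmul_self_le (a : A) (x : P.carrier) :
    ‖P.rip (P.lsmul a x) (P.lsmul a x)‖ ≤ ‖a‖ ^ 2 * ‖P.rip x x‖ := by
  obtain ⟨c, b, hc, hb⟩ := exists_norm_sq_sub_star_mul_self a
  have h := P.isPos_rip_self (c • x + P.lsmul b x)
  have h1 : P.rip (c • x + P.lsmul b x) (c • x + P.lsmul b x) =
      (star c * c) • P.rip x x +
        P.rip x (P.lsmul (star c • b + c • star b + star b * b) x) := by
    simp only [map_add, LinearMap.add_apply, map_smulₛₗ, LinearMap.smul_apply,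
      RingHom.id_apply, P.rip_lsmul, P.mul_lsmul]
    simp only [starRingEnd_apply]
    module
  have h2 : P.rip (P.lsmul a x) (P.lsmul a x) = P.rip x (P.lsmul (star a * a) x) := by
    rw [P.rip_lsmul, P.mul_lsmul]
  rw [h1, hc, hb, map_neg, LinearMap.neg_apply, map_neg, ← sub_eq_add_neg, ← h2] at h
  refine (IsPos.norm_le (P.isPos_rip_self _) h).trans ?_
  rw [norm_smul, Complex.norm_real, Real.norm_of_nonneg (by positivity)]

theorem norm_rip_rsmul_self_le (x : P.carrier) (b : B) :
    ‖P.rip (P.rsmul x b) (P.rsmul x b)‖ ≤ ‖b‖ ^ 2 * ‖P.rip x x‖ := by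
  rw [rip_rsmul_left, P.rip_rsmul]
  calc _ ≤ ‖star b‖ * (‖P.rip x x‖ * ‖b‖) := by
        refine (norm_mul_le _ _).trans ?_
        gcongr
        exact norm_mul_le _ _
    _ = _ := by rw [norm_star]; ring

/-- Gram matrices over a C*-algebra are positive: `(⟨xᵢ, xⱼ⟩)ᵢⱼ = S* S` for a matrix `S`. The
compression of the Gram matrix to its negative part has positive diagonal entries, therefore
the negative part vanishes. -/
theorem exists_gram_eq {n : Type*} [Fintype n] (x : n → P.carrier) :
    ∃ S : n → n → B, ∀ i j, P.rip (x i) (x j) = ∑ k, star (S k i) * S k j := by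
  let := CStarAlgebra.spectralOrder B
  have := CStarAlgebra.spectralOrderedRing B
  classical
  let M : CStarMatrix n n B := CStarMatrix.ofMatrix fun i j => P.rip (x i) (x j)
  have hM : IsSelfAdjoint M := by
    ext i j
    exact P.star_rip _ _
  obtain ⟨N, S, hNS, hS⟩ := exists_compression_neg hM
  have hS0 : S = 0 := by
    ext i k
    have h1 : (star N * M * N) k k =
        P.rip (∑ j, P.rsmul (x j) (N j k)) (∑ j, P.rsmul (x j) (N j k)) := by
      simp only [CStarMatrix.mul_apply, map_sum, LinearMap.sum_apply, P.rip_rsmul,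
        rip_rsmul_left, Finset.sum_mul]
      rfl
    have h2 : (star S * S) k k = ∑ j, star (S j k) * S j k := by
      simp only [CStarMatrix.mul_apply]
      rfl
    have h3 : IsPos ((star N * M * N) k k) := h1 ▸ P.isPos_rip_self _
    have h4 : IsPos (0 - star (S i k) * S i k) := by
      have h5 : 0 - star (S i k) * S i k = (star N * M * N) k k +
          ∑ j ∈ Finset.univ.erase i, star (S j k) * S j k := by
        rw [hNS, CStarMatrix.neg_apply, h2, ← Finset.add_sum_erase _ _ (Finset.mem_univ i)]
        abel
      rw [h5]
      exact h3.add (IsPos.sum _ fun j _ => ⟨_, rfl⟩)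
    have h6 := IsPos.norm_le ⟨_, rfl⟩ h4
    rw [norm_zero, norm_le_zero_iff, CStarRing.star_mul_self_eq_zero_iff] at h6
    exact h6
  obtain ⟨T, hT⟩ := hS hS0
  refine ⟨fun i j => T i j, fun i j => ?_⟩
  change M i j = _
  rw [hT, CStarMatrix.mul_apply]
  rfl

/-- The seminorm `x ↦ ‖⟨x, x⟩‖ ^ (1 / 2)`. -/
noncomputable def seminorm : Seminorm ℂ P.carrier :=
  Seminorm.of (fun x => √‖P.rip x x‖)
    (fun x y => by
      have hxy : ‖P.rip x y‖ ≤ √‖P.rip x x‖ * √‖P.rip y y‖ := by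
        rw [← Real.sqrt_mul (norm_nonneg _)]
        exact Real.le_sqrt_of_sq_le (P.norm_rip_sq_le x y)
      have hyx : ‖P.rip y x‖ ≤ √‖P.rip x x‖ * √‖P.rip y y‖ := by
        rwa [← P.star_rip, norm_star]
      refine Real.sqrt_le_iff.2 ⟨by positivity, ?_⟩
      have hx := Real.sq_sqrt (norm_nonneg (P.rip x x))
      have hy := Real.sq_sqrt (norm_nonneg (P.rip y y))
      calc ‖P.rip (x + y) (x + y)‖
          = ‖P.rip x x + P.rip x y + P.rip y x + P.rip y y‖ := by
            simp only [map_add, LinearMap.add_apply]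
            congr 1
            abel
        _ ≤ ‖P.rip x x‖ + ‖P.rip x y‖ + ‖P.rip y x‖ + ‖P.rip y y‖ := norm_add₄_le
        _ ≤ _ := by nlinarith)
    (fun c x => by
      simp only [map_smulₛₗ, LinearMap.smul_apply, RingHom.id_apply, norm_smul, RCLike.norm_conj]
      rw [← mul_assoc, Real.sqrt_mul (by positivity), Real.sqrt_mul_self (norm_nonneg _)])

theorem seminorm_apply (x : P.carrier) : P.seminorm x = √‖P.rip x x‖ := rfl

theorem seminorm_sq (x : P.carrier) : P.seminorm x ^ 2 = ‖P.rip x x‖ :=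
  Real.sq_sqrt (norm_nonneg _)

theorem norm_rip_le (x y : P.carrier) : ‖P.rip x y‖ ≤ P.seminorm x * P.seminorm y := by
  rw [seminorm_apply, seminorm_apply, ← Real.sqrt_mul (norm_nonneg _)]
  exact Real.le_sqrt_of_sq_le (P.norm_rip_sq_le x y)

theorem seminorm_lsmul_le (a : A) (x : P.carrier) :
    P.seminorm (P.lsmul a x) ≤ ‖a‖ * P.seminorm x := by
  refine Real.sqrt_le_iff.2 ⟨by positivity, ?_⟩
  rw [mul_pow, seminorm_sq]
  exact P.norm_rip_lsmul_self_le a x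

theorem seminorm_rsmul_le (x : P.carrier) (b : B) :
    P.seminorm (P.rsmul x b) ≤ ‖b‖ * P.seminorm x := by
  refine Real.sqrt_le_iff.2 ⟨by positivity, ?_⟩
  rw [mul_pow, seminorm_sq]
  exact P.norm_rip_rsmul_self_le x b

end PreHilbertBimodule

/-! ### Completions -/

/-- A Hausdorff completion of a seminormed space `(V, p)`: a Banach space with a linear map of
`V` onto a dense subspace under which the norm pulls back to `p`. Being given by its properties, it
does not require `p` to be installed as the norm of `V`. -/
structure HausdorffCompletion {V : Type u} [AddCommGroup V] [Module ℂ V]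
    (p : Seminorm ℂ V) where
  /-- the underlying Banach space -/
  space : Type u
  [normed : NormedAddCommGroup space]
  [normedSpace : NormedSpace ℂ space]
  [complete : CompleteSpace space]
  /-- the canonical map -/
  map : V →ₗ[ℂ] space
  denseRange : DenseRange map
  norm_map : ∀ x, ‖map x‖ = p x

attribute [instance] HausdorffCompletion.normed HausdorffCompletion.normedSpace
  HausdorffCompletion.complete

instance HausdorffCompletion.nonempty {V : Type u} [AddCommGroup V] [Module ℂ V]
    (p : Seminorm ℂ V) : Nonempty (HausdorffCompletion p) := by
  let : SeminormedAddCommGroup V := p.toAddGroupSeminorm.toSeminormedAddCommGroup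
  let : NormedSpace ℂ V := { norm_smul_le := fun c x => (map_smul_eq_mul p c x).le }
  exact ⟨{
    space := UniformSpace.Completion V
    map := (UniformSpace.Completion.toComplL (𝕜 := ℂ) (E := V)).toLinearMap
    denseRange := UniformSpace.Completion.denseRange_coe
    norm_map := fun x => UniformSpace.Completion.norm_coe x }⟩

/-- A bounded sesquilinear or bilinear map extends to the completions of its arguments. -/
theorem exists_extend₂ {σ : ℂ →+* ℂ} [RingHomIsometric σ] {V W H K F : Type*}
    [AddCommGroup V] [Module ℂ V] [AddCommGroup W] [Module ℂ W]
    [NormedAddCommGroup H] [NormedSpace ℂ H] [NormedAddCommGroup K] [NormedSpace ℂ K]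
    [NormedAddCommGroup F] [NormedSpace ℂ F] [CompleteSpace F]
    (d : V →ₗ[ℂ] H) (hd : DenseRange d) (e : W →ₗ[ℂ] K) (he : DenseRange e)
    (f : V →ₛₗ[σ] W →ₗ[ℂ] F) (hf : ∀ x y, ‖f x y‖ ≤ ‖d x‖ * ‖e y‖) :
    ∃ g : H →SL[σ] K →L[ℂ] F, ∀ x y, g (d x) (e y) = f x y := by
  have h1 : ∀ x y, (f x).extendOfNorm e (e y) = f x y := fun x y =>
    LinearMap.extendOfNorm_eq he ⟨‖d x‖, hf x⟩ y
  have hext : ∀ g g' : K →L[ℂ] F, (∀ y, g (e y) = g' (e y)) → g = g' := fun g g' h =>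
    ContinuousLinearMap.coeFn_injective
      (he.equalizer g.continuous g'.continuous (funext h))
  let f₁ : V →ₛₗ[σ] K →L[ℂ] F :=
    { toFun := fun x => (f x).extendOfNorm e
      map_add' := fun x x' => hext _ _ fun y => by
        change (f (x + x')).extendOfNorm e (e y) =
          (f x).extendOfNorm e (e y) + (f x').extendOfNorm e (e y)
        rw [h1, h1, h1, map_add, LinearMap.add_apply]
      map_smul' := fun c x => hext _ _ fun y => by
        change (f (c • x)).extendOfNorm e (e y) = σ c • (f x).extendOfNorm e (e y)
        rw [h1, h1, map_smulₛₗ, LinearMap.smul_apply] }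
  have hf₁ : ∀ x, ‖f₁ x‖ ≤ 1 * ‖d x‖ := fun x => by
    rw [one_mul]
    exact LinearMap.opNorm_extendOfNorm_le he (norm_nonneg _) (hf x)
  refine ⟨f₁.extendOfNorm d, fun x y => ?_⟩
  rw [LinearMap.extendOfNorm_eq hd ⟨1, hf₁⟩]
  exact h1 x y

/-- Strong continuity of a family of contractions passes to the closed span. -/
theorem continuous_orbit_of_mem_closure_span {G H K : Type*} [TopologicalSpace G]
    [NormedAddCommGroup H] [NormedSpace ℂ H] [NormedAddCommGroup K] [NormedSpace ℂ K]
    (T : G → H →ₗ[ℂ] K) (hT : ∀ s x, ‖T s x‖ ≤ ‖x‖) {S : Set H}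
    (h : ∀ x ∈ S, Continuous fun s => T s x) {x : H}
    (hx : x ∈ closure (Submodule.span ℂ S : Set H)) : Continuous fun s => T s x := by
  have hspan : ∀ y ∈ Submodule.span ℂ S, Continuous fun s => T s y := by
    intro y hy
    induction hy using Submodule.span_induction with
    | mem y hy => exact h y hy
    | zero => simpa using continuous_const
    | add y z _ _ hy hz => simpa only [map_add] using hy.fun_add hz
    | smul c y _ hy => simpa only [map_smul] using hy.fun_const_smul c
  refine continuous_of_uniform_approx_of_continuous fun U hU => ?_
  obtain ⟨ε, hε, hεU⟩ := Metric.mem_uniformity_dist.1 hU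
  obtain ⟨y, hy, hxy⟩ := Metric.mem_closure_iff.1 hx ε hε
  refine ⟨fun s => T s y, hspan y hy, fun s => hεU ?_⟩
  rw [dist_eq_norm, ← map_sub]
  exact (hT s _).trans_lt (by rwa [← dist_eq_norm])

theorem CStarSystem.norm_act {G : Type v} [Group G] [TopologicalSpace G]
    (A : CStarSystem.{u} G) (s : G) (a : A.alg) : ‖A.act s a‖ = ‖a‖ :=
  (NonUnitalStarAlgHom.isometry (A.act s) (A.act s).injective).norm_map_of_map_zero
    (map_zero _) a

namespace PreHilbertBimodule

variable {G : Type v} [Group G] [TopologicalSpace G] {A B : CStarSystem.{u} G}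

/-- A pre-Hilbert bimodule with a compatible action of `G` has a completion, provided that it is
full, and that nondegeneracy and strong continuity hold for the norm of the completion. -/
theorem exists_completion (P : PreHilbertBimodule.{u} A.alg B.alg)
    (act : G →* (P.carrier ≃ₗ[ℂ] P.carrier))
    (act_lsmul : ∀ s a x, act s (P.lsmul a x) = P.lsmul (A.act s a) (act s x))
    (rip_act : ∀ s x y, P.rip (act s x) (act s y) = B.act s (P.rip x y))
    (full : Dense (Submodule.span ℂ {b : B.alg | ∃ x y, P.rip x y = b} : Set B.alg))
    (K : HausdorffCompletion P.seminorm)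
    (nondegenerate :
      Dense (Submodule.span ℂ {z | ∃ a x, K.map (P.lsmul a x) = z} : Set K.space))
    {S : Set P.carrier} (hS : Submodule.span ℂ S = ⊤)
    (continuous_act : ∀ x ∈ S, Continuous fun s => K.map (act s x)) :
    ∃ (Z : EquivariantBimodule A B) (q : P.carrier →ₗ[ℂ] Z.carrier), DenseRange q ∧
      (∀ x y, Z.rip (q x) (q y) = P.rip x y) ∧
      (∀ a x, Z.lsmul a (q x) = q (P.lsmul a x)) ∧
      (∀ x b, Z.rsmul (q x) b = q (P.rsmul x b)) ∧
      (∀ s x, Z.act s (q x) = q (act s x)) := by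
  have hq := K.denseRange
  obtain ⟨r, hr⟩ := exists_extend₂ K.map hq K.map hq P.rip (fun x y => by
    rw [K.norm_map, K.norm_map]
    exact P.norm_rip_le x y)
  obtain ⟨l, hl⟩ := exists_extend₂ (LinearMap.id : A.alg →ₗ[ℂ] A.alg) denseRange_id K.map hq
    (P.lsmul.compr₂ K.map) (fun a x => by
      simpa [K.norm_map] using P.seminorm_lsmul_le a x)
  obtain ⟨m, hm⟩ := exists_extend₂ K.map hq (LinearMap.id : B.alg →ₗ[ℂ] B.alg) denseRange_id
    (P.rsmul.compr₂ K.map) (fun x b => by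
      simpa [K.norm_map, mul_comm] using P.seminorm_rsmul_le x b)
  replace hl : ∀ a x, l a (K.map x) = K.map (P.lsmul a x) := hl
  replace hm : ∀ x b, m (K.map x) b = K.map (P.rsmul x b) := hm
  have hnorm : ∀ s x, ‖K.map (act s x)‖ = ‖K.map x‖ := fun s x => by
    rw [K.norm_map, K.norm_map, P.seminorm_apply, P.seminorm_apply, rip_act,
      B.norm_act]
  let T : G → K.space →L[ℂ] K.space := fun s => (K.map ∘ₗ (act s).toLinearMap).extendOfNorm K.map
  have hT : ∀ s x, T s (K.map x) = K.map (act s x) := fun s x =>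
    LinearMap.extendOfNorm_eq hq ⟨1, fun x => by simpa using (hnorm s x).le⟩ x
  have hTmul : ∀ s t x, T (s * t) x = T s (T t x) := fun s t x =>
    hq.induction_on x (isClosed_eq (by fun_prop) (by fun_prop)) fun x => by
      simp [hT]
  have hTone : ∀ x, T 1 x = x := fun x =>
    hq.induction_on x (isClosed_eq (by fun_prop) (by fun_prop)) fun x => by
      simp [hT]
  have rip_rsmul : ∀ x y b, r x (m y b) = r x y * b := fun x y b =>
    hq.induction_on₂ (p := fun x y => r x (m y b) = r x y * b)
      (isClosed_eq (by fun_prop) (by fun_prop))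
      (fun x y => by rw [hm, hr, hr, P.rip_rsmul]) x y
  have star_rip : ∀ x y, star (r x y) = r y x := fun x y =>
    hq.induction_on₂ (p := fun x y => star (r x y) = r y x)
      (isClosed_eq (by fun_prop) (by fun_prop))
      (fun x y => by rw [hr, hr, P.star_rip]) x y
  have rip_lsmul : ∀ a x y, r (l a x) y = r x (l (star a) y) := fun a x y =>
    hq.induction_on₂ (p := fun x y => r (l a x) y = r x (l (star a) y))
      (isClosed_eq (by fun_prop) (by fun_prop))
      (fun x y => by rw [hl, hl, hr, hr, P.rip_lsmul]) x y
  have rip_T : ∀ s x y, r (T s x) (T s y) = B.act s (r x y) := fun s x y =>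
    hq.induction_on₂ (p := fun x y => r (T s x) (T s y) = B.actL s (r x y))
      (isClosed_eq (by fun_prop) (by fun_prop))
      (fun x y => by rw [hT, hT, hr, hr, rip_act]; rfl) x y
  have norm_sq : ∀ x, ‖x‖ ^ 2 = ‖r x x‖ := fun x =>
    hq.induction_on x (isClosed_eq (by fun_prop) (by fun_prop)) fun x => by
      rw [hr, K.norm_map, P.seminorm_sq]
  have ext_rip : ∀ x y, (∀ z, r z x = r z y) → x = y := fun x y h => by
    have := norm_sq (x - y)
    rw [map_sub (r (x - y)), h, sub_self, norm_zero] at this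
    simpa [sub_eq_zero] using this
  have norm_T : ∀ s x, ‖T s x‖ ≤ ‖x‖ := fun s x => by
    refine (sq_le_sq₀ (norm_nonneg _) (norm_nonneg _)).1 ?_
    rw [norm_sq, norm_sq, rip_T, B.norm_act]
  let Z : EquivariantBimodule A B :=
    { carrier := K.space
      rsmul := (ContinuousLinearMap.coeLM ℂ).comp m.toLinearMap
      lsmul := (ContinuousLinearMap.coeLM ℂ).comp l.toLinearMap
      rip := (ContinuousLinearMap.coeLM ℂ).comp r.toLinearMap
      rsmul_mul := fun x b c => ext_rip _ _ fun z => by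
        change r z (m x (b * c)) = r z (m (m x b) c)
        simp only [rip_rsmul, mul_assoc]
      rip_rsmul := rip_rsmul
      star_rip := star_rip
      rip_self_nonneg := fun x =>
        hq.induction_on (p := fun x => IsPos (r x x)) x
          (isClosed_isPos.preimage (f := fun x => r x x) (by fun_prop)) fun x => by
            rw [hr]
            exact P.isPos_rip_self x
      norm_sq := norm_sq
      full := full.mono (Submodule.span_mono (by
        rintro _ ⟨x, y, rfl⟩
        exact ⟨K.map x, K.map y, hr x y⟩))
      mul_lsmul := fun a a' x =>
        hq.induction_on (p := fun x => l (a * a') x = l a (l a' x)) x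
          (isClosed_eq (by fun_prop) (by fun_prop)) fun x => by
            rw [hl, hl, hl, P.mul_lsmul]
      lsmul_rsmul := fun a x b => ext_rip _ _ fun z => by
        have rip_lsmul' : ∀ y, r z (l a y) = r (l (star a) z) y := fun y => by
          rw [rip_lsmul, star_star]
        change r z (l a (m x b)) = r z (m (l a x) b)
        rw [rip_lsmul', rip_rsmul, rip_rsmul, rip_lsmul']
      rip_lsmul := rip_lsmul
      nondegenerate := nondegenerate.mono (Submodule.span_mono (by
        rintro _ ⟨a, x, rfl⟩
        exact ⟨a, K.map x, hl a x⟩))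
      act :=
        { toFun := fun s => LinearEquiv.ofLinearMap (T s).toLinearMap (T s⁻¹).toLinearMap
            (by ext x; change T s (T s⁻¹ x) = x; rw [← hTmul, mul_inv_cancel, hTone])
            (by ext x; change T s⁻¹ (T s x) = x; rw [← hTmul, inv_mul_cancel, hTone])
          map_one' := LinearEquiv.ext hTone
          map_mul' := fun s t => LinearEquiv.ext (hTmul s t) }
      act_lsmul := fun s a x =>
        hq.induction_on (p := fun x => T s (l a x) = l (A.act s a) (T s x)) x
          (isClosed_eq (by fun_prop) (by fun_prop)) fun x => by
            rw [hl, hT, hT, hl, act_lsmul]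
      act_rsmul := fun s x b => ext_rip _ _ fun z => by
        obtain ⟨z, rfl⟩ : ∃ w, T s w = z := ⟨T s⁻¹ z, by rw [← hTmul, mul_inv_cancel, hTone]⟩
        change r (T s z) (T s (m x b)) = r (T s z) (m (T s x) (B.act s b))
        rw [rip_T, rip_rsmul, rip_rsmul, rip_T, map_mul]
      rip_act := rip_T
      continuous_act := fun x => by
        refine continuous_orbit_of_mem_closure_span (fun s => (T s).toLinearMap) norm_T
          (S := K.map '' S) ?_ ?_
        · rintro _ ⟨x, hx, rfl⟩
          change Continuous fun s => T s (K.map x)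
          simpa only [hT] using continuous_act x hx
        · rw [Submodule.span_image, hS, ← LinearMap.range_eq_map]
          exact hq x }
  exact ⟨Z, K.map, hq, hr, hl, hm, hT⟩

end PreHilbertBimodule

/-! ### Right-Hilbert bimodules -/

/-- A closed subspace that contains the image of a total set contains the whole range. -/
theorem mem_of_dense_span {σ : ℂ →+* ℂ} {V W : Type*} [NormedAddCommGroup V] [NormedSpace ℂ V]
    [NormedAddCommGroup W] [NormedSpace ℂ W] {S : Set V}
    (hS : Dense (Submodule.span ℂ S : Set V)) (f : V →SL[σ] W) {M : Submodule ℂ W}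
    (hM : IsClosed (M : Set W)) (h : ∀ x ∈ S, f x ∈ M) (x : V) : f x ∈ M := by
  have h1 : Submodule.span ℂ S ≤ M.comap f.toLinearMap := Submodule.span_le.2 h
  exact closure_minimal (s := (Submodule.span ℂ S : Set V)) (t := f ⁻¹' (M : Set W)) h1
    (hM.preimage f.continuous) (hS x)

/-- A set whose closed span contains a total set is total. -/
theorem Dense.span_of_subset_closure {V : Type*} [NormedAddCommGroup V] [NormedSpace ℂ V]
    {S T : Set V} (hS : Dense (Submodule.span ℂ S : Set V))
    (h : ∀ x ∈ S, x ∈ (Submodule.span ℂ T).topologicalClosure) :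
    Dense (Submodule.span ℂ T : Set V) :=
  fun x => mem_of_dense_span hS (ContinuousLinearMap.id ℂ V)
    (Submodule.isClosed_topologicalClosure _) h x

namespace RightHilbertBimodule

variable {A B : Type u} [NonUnitalCStarAlgebra A] [NonUnitalCStarAlgebra B]
  (X : RightHilbertBimodule A B)

/-- The pre-Hilbert bimodule that underlies a right-Hilbert bimodule. -/
noncomputable def toPre : PreHilbertBimodule.{u} A B where
  carrier := X.carrier
  rsmul := X.rsmul
  lsmul := X.lsmul
  rip := X.rip
  rip_rsmul := X.rip_rsmul
  star_rip := X.star_rip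
  isPos_rip_self := X.rip_self_nonneg
  mul_lsmul := X.mul_lsmul
  rip_lsmul := X.rip_lsmul

theorem seminorm_toPre (x : X.carrier) : X.toPre.seminorm x = ‖x‖ := by
  change √‖X.rip x x‖ = _
  rw [← X.norm_sq, Real.sqrt_sq (norm_nonneg _)]

theorem norm_rip_le (x y : X.carrier) : ‖X.rip x y‖ ≤ ‖x‖ * ‖y‖ := by
  have := X.toPre.norm_rip_le x y
  rwa [seminorm_toPre, seminorm_toPre] at this

theorem norm_lsmul_le (a : A) (x : X.carrier) : ‖X.lsmul a x‖ ≤ ‖a‖ * ‖x‖ := by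
  rw [← seminorm_toPre, ← X.seminorm_toPre x]
  exact X.toPre.seminorm_lsmul_le a x

theorem norm_rsmul_le (x : X.carrier) (b : B) : ‖X.rsmul x b‖ ≤ ‖x‖ * ‖b‖ := by
  rw [mul_comm, ← seminorm_toPre, ← X.seminorm_toPre x]
  exact X.toPre.seminorm_rsmul_le x b

/-- The inner product as a continuous sesquilinear map. -/
noncomputable def ripL : X.carrier →L⋆[ℂ] X.carrier →L[ℂ] B :=
  X.rip.mkContinuous₂ 1 fun x y => by simpa using X.norm_rip_le x y

/-- The left action as a continuous bilinear map. -/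
noncomputable def lsmulL : A →L[ℂ] X.carrier →L[ℂ] X.carrier :=
  X.lsmul.mkContinuous₂ 1 fun a x => by simpa using X.norm_lsmul_le a x

/-- The right action as a continuous bilinear map. -/
noncomputable def rsmulL : X.carrier →L[ℂ] B →L[ℂ] X.carrier :=
  X.rsmul.mkContinuous₂ 1 fun x b => by simpa using X.norm_rsmul_le x b

@[simp] theorem ripL_apply (x y : X.carrier) : X.ripL x y = X.rip x y := rfl

@[simp] theorem lsmulL_apply (a : A) (x : X.carrier) : X.lsmulL a x = X.lsmul a x := rfl

@[simp] theorem rsmulL_apply (x : X.carrier) (b : B) : X.rsmulL x b = X.rsmul x b := rfl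

theorem rip_rsmul_left (x y : X.carrier) (b : B) : X.rip (X.rsmul x b) y = star b * X.rip x y :=
  X.toPre.rip_rsmul_left x y b

theorem eq_zero_of_rip_self {x : X.carrier} (h : X.rip x x = 0) : x = 0 := by
  have := X.norm_sq x
  rw [h, norm_zero] at this
  simpa using this

theorem ext_rip {x y : X.carrier} (h : ∀ z, X.rip z x = X.rip z y) : x = y := by
  rw [← sub_eq_zero]
  apply X.eq_zero_of_rip_self
  rw [map_sub (X.rip (x - y)), h, sub_self]

theorem ext_rip_of_denseRange {ι : Type*} {q : ι → X.carrier} (hq : DenseRange q)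
    {x y : X.carrier} (h : ∀ i, X.rip (q i) x = X.rip (q i) y) : x = y := by
  refine X.ext_rip fun z => hq.induction_on (p := fun z => X.ripL z x = X.ripL z y) z
    (isClosed_eq (by fun_prop) (by fun_prop)) h

/-- The right action of a C*-algebra on a Hilbert module is nondegenerate. -/
theorem dense_span_rsmul :
    Dense (Submodule.span ℂ {z : X.carrier | ∃ x b, X.rsmul x b = z} : Set X.carrier) := by
  let := CStarAlgebra.spectralOrder B
  have := CStarAlgebra.spectralOrderedRing B
  intro x
  have h := CStarAlgebra.increasingApproximateUnit B
  have := h.neBot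
  refine mem_closure_of_tendsto
    (f := fun e => X.rsmul x e) (b := CStarAlgebra.approximateUnit B) ?_
    (Filter.Eventually.of_forall fun e => Submodule.subset_span ⟨_, _, rfl⟩)
  rw [tendsto_iff_norm_sub_tendsto_zero]
  -- For a contraction `e`, `‖xe - x‖² = ‖e*(pe - p) - (pe - p)‖ ≤ 2 ‖pe - p‖`, with `p = ⟨x, x⟩`.
  have hp : Filter.Tendsto (fun e => 2 * ‖X.rip x x * e - X.rip x x‖)
      (CStarAlgebra.approximateUnit B) (nhds 0) := by
    simpa using (tendsto_iff_norm_sub_tendsto_zero.1 (h.tendsto_mul_left (X.rip x x))).const_mul 2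
  have hsq : Filter.Tendsto (fun e => ‖X.rsmul x e - x‖ ^ 2)
      (CStarAlgebra.approximateUnit B) (nhds 0) := by
    refine squeeze_zero' (Filter.Eventually.of_forall fun e => by positivity) ?_ hp
    filter_upwards [h.eventually_norm] with e he
    have h1 : X.rip (X.rsmul x e - x) (X.rsmul x e - x) =
        star e * (X.rip x x * e - X.rip x x) - (X.rip x x * e - X.rip x x) := by
      simp only [map_sub, LinearMap.sub_apply, X.rip_rsmul, X.rip_rsmul_left, mul_sub, mul_assoc]
      abel
    rw [X.norm_sq, h1, two_mul]
    refine (norm_sub_le _ _).trans (add_le_add_left ((norm_mul_le _ _).trans ?_) _)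
    rw [norm_star]
    exact mul_le_of_le_one_left (norm_nonneg _) he
  simpa [Real.sqrt_sq (norm_nonneg _)] using hsq.sqrt

end RightHilbertBimodule

namespace EquivariantBimodule

variable {G : Type v} [Group G] [TopologicalSpace G] {A B C D : CStarSystem.{u} G}

theorem norm_act (X : EquivariantBimodule A B) (s : G) (x : X.carrier) : ‖X.act s x‖ = ‖x‖ := by
  refine (sq_eq_sq₀ (norm_nonneg _) (norm_nonneg _)).1 ?_
  rw [X.norm_sq, X.norm_sq, X.rip_act, B.norm_act]

/-- The operator `γ_s` as a continuous linear map. -/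
noncomputable def actL (X : EquivariantBimodule A B) (s : G) : X.carrier →L[ℂ] X.carrier :=
  (X.act s).toLinearMap.mkContinuous 1 fun x => by simpa using (X.norm_act s x).le

@[simp] theorem actL_apply (X : EquivariantBimodule A B) (s : G) (x : X.carrier) :
    X.actL s x = X.act s x := rfl

theorem act_inv_act (X : EquivariantBimodule A B) (s : G) (x : X.carrier) :
    X.act s⁻¹ (X.act s x) = x := by
  rw [← LinearEquiv.mul_apply, ← map_mul, inv_mul_cancel, map_one]
  rfl

theorem act_act_inv (X : EquivariantBimodule A B) (s : G) (x : X.carrier) :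
    X.act s (X.act s⁻¹ x) = x := by
  rw [← LinearEquiv.mul_apply, ← map_mul, mul_inv_cancel, map_one]
  rfl

/-- Two bimodules which are both generated by a vector space `V`, in such a way that the inner
products, the left actions and the actions of `G` agree on the images of a spanning set of `V`,
are isomorphic. -/
theorem isomorphic_of_denseRange {V : Type*} [AddCommGroup V] [Module ℂ V]
    (X Y : EquivariantBimodule A B) (p : V →ₗ[ℂ] X.carrier) (q : V →ₗ[ℂ] Y.carrier)
    (hp : DenseRange p) (hq : DenseRange q) {S : Set V} (hS : Submodule.span ℂ S = ⊤)
    (hrip : ∀ u ∈ S, ∀ v ∈ S, X.rip (p u) (p v) = Y.rip (q u) (q v))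
    (hl : ∀ a, ∀ v ∈ S, ∃ w, X.lsmul a (p v) = p w ∧ Y.lsmul a (q v) = q w)
    (hact : ∀ s, ∀ v ∈ S, ∃ w, X.act s (p v) = p w ∧ Y.act s (q v) = q w) :
    X.Isomorphic Y := by
  have hrip1 : ∀ u ∈ S, ∀ v, X.rip (p u) (p v) = Y.rip (q u) (q v) := fun u hu v =>
    LinearMap.congr_fun (LinearMap.ext_on hS (f := (X.rip (p u)) ∘ₗ p) (g := (Y.rip (q u)) ∘ₗ q)
      fun v hv => hrip u hu v hv) v
  have hrip' : ∀ u v, X.rip (p u) (p v) = Y.rip (q u) (q v) := fun u v =>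
    LinearMap.congr_fun (LinearMap.ext_on hS
      (f := (X.rip.flip (p v)) ∘ₛₗ p) (g := (Y.rip.flip (q v)) ∘ₛₗ q)
      fun u hu => hrip1 u hu v) u
  have hnorm : ∀ v, ‖q v‖ = ‖p v‖ := fun v => by
    refine (sq_eq_sq₀ (norm_nonneg _) (norm_nonneg _)).1 ?_
    rw [X.norm_sq, Y.norm_sq, hrip']
  let Φ := (LinearEquiv.refl ℂ V).extendOfIsometry p q hp hq hnorm
  have hΦ : ∀ v, Φ (p v) = q v := fun v =>
    LinearEquiv.extendOfIsometry_eq (LinearEquiv.refl ℂ V) p q hp hq hnorm v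
  have hΦL : ∀ v, Φ.toLinearIsometry.toContinuousLinearMap (p v) = q v := hΦ
  have hΦrip : ∀ x y, Y.rip (Φ x) (Φ y) = X.rip x y := fun x y =>
    hp.induction_on₂ (p := fun x y => Y.ripL (Φ x) (Φ y) = X.ripL x y)
      (isClosed_eq (by fun_prop) (by fun_prop))
      (fun u v => by simp [hΦ, hrip']) x y
  have hdense : Dense (Submodule.span ℂ (p '' S) : Set X.carrier) := by
    rw [Submodule.span_image, hS, ← LinearMap.range_eq_map]
    exact hp
  -- Two continuous linear maps on `X` agree if they agree on the image of `S`.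
  have hext : ∀ f g : X.carrier →L[ℂ] Y.carrier, (∀ v ∈ S, f (p v) = g (p v)) → f = g :=
    fun f g h => by
      ext x
      have := mem_of_dense_span hdense (f - g) (M := ⊥) (by simp) (by
        rintro _ ⟨v, hv, rfl⟩
        simp [h v hv]) x
      simpa [sub_eq_zero] using this
  refine ⟨Φ.toLinearEquiv, fun a x => ?_, fun x b => ?_, hΦrip, fun s x => ?_⟩
  · refine DFunLike.congr_fun (hext
      (Φ.toLinearIsometry.toContinuousLinearMap ∘L X.lsmulL a)
      (Y.lsmulL a ∘L Φ.toLinearIsometry.toContinuousLinearMap) fun v hv => ?_) x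
    obtain ⟨w, h1, h2⟩ := hl a v hv
    simp only [ContinuousLinearMap.comp_apply, hΦL, RightHilbertBimodule.lsmulL_apply, h1, h2]
  · refine Y.ext_rip_of_denseRange Φ.surjective.denseRange fun z => ?_
    change Y.rip (Φ z) (Φ (X.rsmul x b)) = Y.rip (Φ z) (Y.rsmul (Φ x) b)
    rw [hΦrip, Y.rip_rsmul, hΦrip, X.rip_rsmul]
  · refine DFunLike.congr_fun (hext
      (Φ.toLinearIsometry.toContinuousLinearMap ∘L X.actL s)
      (Y.actL s ∘L Φ.toLinearIsometry.toContinuousLinearMap) fun v hv => ?_) x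
    obtain ⟨w, h1, h2⟩ := hact s v hv
    simp only [ContinuousLinearMap.comp_apply, hΦL, actL_apply, h1, h2]

end EquivariantBimodule

/-! ### Balanced tensor products -/

namespace EquivariantBimodule

variable {G : Type v} [Group G] [TopologicalSpace G] {A B C D : CStarSystem.{u} G}

/-- The inner product `⟨x ⊗ y, z ⊗ w⟩ = ⟨y, ⟨x, z⟩ · w⟩` on the algebraic tensor product. -/
noncomputable def tensorRip (X : EquivariantBimodule A B) (Y : EquivariantBimodule B C) :
    X.carrier ⊗[ℂ] Y.carrier →ₗ⋆[ℂ] X.carrier ⊗[ℂ] Y.carrier →ₗ[ℂ] C.alg :=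
  TensorProduct.lift (LinearMap.mk₂'ₛₗ (starRingEnd ℂ) (starRingEnd ℂ)
    (fun x y => TensorProduct.lift ((Y.lsmul ∘ₗ X.rip x).compr₂ (Y.rip y)))
    (fun x x' y => TensorProduct.ext' fun z w => by simp)
    (fun c x y => TensorProduct.ext' fun z w => by simp)
    (fun x y y' => TensorProduct.ext' fun z w => by simp)
    (fun c x y => TensorProduct.ext' fun z w => by simp))

@[simp] theorem tensorRip_tmul (X : EquivariantBimodule A B) (Y : EquivariantBimodule B C)
    (x y z w) : tensorRip X Y (x ⊗ₜ y) (z ⊗ₜ w) = Y.rip y (Y.lsmul (X.rip x z) w) := rfl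

/-- Positivity of the inner product on `X ⊙ Y`: with `⟨xᵢ, xⱼ⟩ = ∑ₖ Sₖᵢ* Sₖⱼ`, the inner square of
`∑ᵢ xᵢ ⊗ yᵢ` is the sum of the inner squares of the vectors `∑ᵢ Sₖᵢ · yᵢ`. -/
theorem isPos_tensorRip_self (X : EquivariantBimodule A B) (Y : EquivariantBimodule B C)
    (t : X.carrier ⊗[ℂ] Y.carrier) : IsPos (tensorRip X Y t t) := by
  obtain ⟨s, rfl⟩ := TensorProduct.exists_finset t
  obtain ⟨S, hS⟩ := X.toPre.exists_gram_eq (fun i : s => i.1.1)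
  have h : tensorRip X Y (∑ i ∈ s, i.1 ⊗ₜ i.2) (∑ i ∈ s, i.1 ⊗ₜ i.2) =
      ∑ k, Y.rip (∑ i, Y.lsmul (S k i) i.1.2) (∑ j, Y.lsmul (S k j) j.1.2) := by
    have hS' : ∀ i j : s, X.rip i.1.1 j.1.1 = ∑ k, star (S k i) * S k j := hS
    rw [← Finset.sum_coe_sort s (fun i => i.1 ⊗ₜ[ℂ] i.2)]
    simp only [map_sum, LinearMap.sum_apply, tensorRip_tmul, Y.rip_lsmul, ← Y.mul_lsmul, hS']
    exact (Finset.sum_congr rfl fun i _ => Finset.sum_comm).trans Finset.sum_comm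
  rw [h]
  exact IsPos.sum _ fun k _ => Y.rip_self_nonneg _

/-- The algebraic tensor product as a pre-Hilbert bimodule. -/
noncomputable def tensorPre (X : EquivariantBimodule A B) (Y : EquivariantBimodule B C) :
    PreHilbertBimodule.{u} A.alg C.alg where
  carrier := X.carrier ⊗[ℂ] Y.carrier
  rsmul := (LinearMap.lTensorHom X.carrier ∘ₗ Y.rsmul.flip).flip
  lsmul := LinearMap.rTensorHom Y.carrier ∘ₗ X.lsmul
  rip := tensorRip X Y
  rip_rsmul s t c := by
    induction s with
    | zero => simp
    | add s s' hs hs' => simp only [map_add, LinearMap.add_apply, hs, hs', add_mul]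
    | tmul x y =>
      induction t with
      | zero => simp
      | add t t' ht ht' => simp_all [add_mul]
      | tmul z w => simp [Y.rip_rsmul, Y.lsmul_rsmul]
  star_rip s t := by
    induction s with
    | zero => simp
    | add s s' hs hs' => simp [hs, hs']
    | tmul x y =>
      induction t with
      | zero => simp
      | add t t' ht ht' => simp [ht, ht']
      | tmul z w => simp [Y.star_rip, Y.rip_lsmul, X.star_rip]
  isPos_rip_self := isPos_tensorRip_self X Y
  mul_lsmul a a' t := by
    have : X.lsmul (a * a') = X.lsmul a * X.lsmul a' := LinearMap.ext (X.mul_lsmul a a')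
    simp [this, LinearMap.rTensor_mul]
  rip_lsmul a s t := by
    induction s with
    | zero => simp
    | add s s' hs hs' => simp only [map_add, LinearMap.add_apply, hs, hs']
    | tmul x y =>
      induction t with
      | zero => simp
      | add t t' ht ht' => simp_all
      | tmul z w => simp [X.rip_lsmul]

/-- `q` is the canonical map of `X ⊙ Y` into the balanced tensor product `Z`. The compatibility with
the right action follows from the form of the inner product, see `rsmul_map`. -/
structure IsBalancedTensorMap (X : EquivariantBimodule A B) (Y : EquivariantBimodule B C)
    (Z : EquivariantBimodule A C) (q : X.carrier ⊗[ℂ] Y.carrier →ₗ[ℂ] Z.carrier) : Prop where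
  denseRange : DenseRange q
  rip_map : ∀ x y z w, Z.rip (q (x ⊗ₜ y)) (q (z ⊗ₜ w)) = Y.rip y (Y.lsmul (X.rip x z) w)
  lsmul_map : ∀ a x y, Z.lsmul a (q (x ⊗ₜ y)) = q (X.lsmul a x ⊗ₜ y)
  act_map : ∀ s x y, Z.act s (q (x ⊗ₜ y)) = q (X.act s x ⊗ₜ Y.act s y)

theorem span_tmul_eq_top (X : EquivariantBimodule A B) (Y : EquivariantBimodule B C) :
    Submodule.span ℂ {t : X.carrier ⊗[ℂ] Y.carrier | ∃ x y, x ⊗ₜ y = t} = ⊤ :=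
  TensorProduct.span_tmul_eq_top ℂ X.carrier Y.carrier

namespace IsBalancedTensorMap

variable {X : EquivariantBimodule A B} {Y : EquivariantBimodule B C}
  {Z : EquivariantBimodule A C} {q : X.carrier ⊗[ℂ] Y.carrier →ₗ[ℂ] Z.carrier}

theorem rip_map_left (h : IsBalancedTensorMap X Y Z q) (z w t) :
    Z.rip (q t) (q (z ⊗ₜ w)) = tensorRip X Y t (z ⊗ₜ w) := by
  induction t with
  | zero => simp
  | add t t' ht ht' => simp [ht, ht']
  | tmul x y => exact h.rip_map x y z w

theorem rsmul_map (h : IsBalancedTensorMap X Y Z q) (x y c) :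
    Z.rsmul (q (x ⊗ₜ y)) c = q (x ⊗ₜ Y.rsmul y c) := by
  refine Z.ext_rip_of_denseRange h.denseRange fun t => ?_
  rw [Z.rip_rsmul, h.rip_map_left, h.rip_map_left]
  have := ((tensorPre X Y).rip_rsmul t (x ⊗ₜ y) c).symm
  exact this

theorem isBalancedTensor (h : IsBalancedTensorMap X Y Z q) : X.IsBalancedTensor Y Z :=
  ⟨q, h.denseRange, h.rip_map, h.lsmul_map, h.rsmul_map, h.act_map⟩

theorem norm_map_tmul_le (h : IsBalancedTensorMap X Y Z q) (x y) :
    ‖q (x ⊗ₜ y)‖ ≤ ‖x‖ * ‖y‖ := by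
  refine (sq_le_sq₀ (norm_nonneg _) (by positivity)).1 ?_
  rw [Z.norm_sq, h.rip_map]
  calc _ ≤ ‖y‖ * ‖Y.lsmul (X.rip x x) y‖ := Y.norm_rip_le _ _
    _ ≤ ‖y‖ * (‖X.rip x x‖ * ‖y‖) := by gcongr; exact Y.norm_lsmul_le _ _
    _ = _ := by rw [← X.norm_sq]; ring

/-- The canonical bilinear map `(x, y) ↦ x ⊗ y` into the balanced tensor product. -/
noncomputable def tmulL (h : IsBalancedTensorMap X Y Z q) :
    X.carrier →L[ℂ] Y.carrier →L[ℂ] Z.carrier :=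
  ((TensorProduct.mk ℂ X.carrier Y.carrier).compr₂ q).mkContinuous₂ 1 fun x y => by
    simpa using h.norm_map_tmul_le x y

@[simp] theorem tmulL_apply (h : IsBalancedTensorMap X Y Z q) (x y) :
    h.tmulL x y = q (x ⊗ₜ y) := rfl

theorem dense_span_tmul (h : IsBalancedTensorMap X Y Z q) :
    Dense (Submodule.span ℂ {z | ∃ x y, q (x ⊗ₜ y) = z} : Set Z.carrier) := by
  have : {z | ∃ x y, q (x ⊗ₜ y) = z} = q '' {t | ∃ x y, x ⊗ₜ y = t} := by
    ext z
    simp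
  rw [this, Submodule.span_image, span_tmul_eq_top, ← LinearMap.range_eq_map]
  exact h.denseRange

/-- Vectors of `X ⊗ Y` built from dense subspaces of `X` and `Y` are dense. -/
theorem denseRange_comp_map (h : IsBalancedTensorMap X Y Z q) {V W : Type*}
    [AddCommGroup V] [Module ℂ V] [AddCommGroup W] [Module ℂ W]
    {f : V →ₗ[ℂ] X.carrier} (hf : DenseRange f) {g : W →ₗ[ℂ] Y.carrier} (hg : DenseRange g) :
    DenseRange (q ∘ₗ TensorProduct.map f g) := by
  have hcl := (LinearMap.range (q ∘ₗ TensorProduct.map f g)).isClosed_topologicalClosure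
  have key : ∀ x y, h.tmulL x y ∈
      (LinearMap.range (q ∘ₗ TensorProduct.map f g)).topologicalClosure := fun x y =>
    hf.induction_on (p := fun x => h.tmulL x y ∈
        (LinearMap.range (q ∘ₗ TensorProduct.map f g)).topologicalClosure) x
      (hcl.preimage (f := fun x => h.tmulL x y) (by fun_prop)) fun v =>
      hg.induction_on (p := fun y => h.tmulL (f v) y ∈
          (LinearMap.range (q ∘ₗ TensorProduct.map f g)).topologicalClosure) y
        (hcl.preimage (f := fun y => h.tmulL (f v) y) (by fun_prop)) fun w =>
        Submodule.le_topologicalClosure _ ⟨v ⊗ₜ w, rfl⟩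
  intro z
  exact mem_of_dense_span h.dense_span_tmul (ContinuousLinearMap.id ℂ _) hcl
    (by rintro _ ⟨x, y, rfl⟩; exact key x y) z

/-- Balanced tensor products are determined up to isomorphism, and invariant under isomorphisms of
the factors. The isomorphisms appear here as maps `Φ` and `Ψ` with dense range. -/
theorem isomorphic {X' : EquivariantBimodule A B} {Y' : EquivariantBimodule B C}
    {Z' : EquivariantBimodule A C} {q' : X'.carrier ⊗[ℂ] Y'.carrier →ₗ[ℂ] Z'.carrier}
    (h : IsBalancedTensorMap X Y Z q) (h' : IsBalancedTensorMap X' Y' Z' q')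
    (hX : X.Isomorphic X') (hY : Y.Isomorphic Y') : Z.Isomorphic Z' := by
  obtain ⟨Φ, hΦl, -, hΦrip, hΦact⟩ := hX
  obtain ⟨Ψ, hΨl, -, hΨrip, hΨact⟩ := hY
  refine isomorphic_of_denseRange Z Z' q (q' ∘ₗ TensorProduct.map Φ.toLinearMap Ψ.toLinearMap)
    h.denseRange (h'.denseRange_comp_map Φ.surjective.denseRange Ψ.surjective.denseRange)
    (span_tmul_eq_top X Y) ?_ ?_ ?_
  · rintro _ ⟨x, y, rfl⟩ _ ⟨z, w, rfl⟩
    simp [h.rip_map, h'.rip_map, hΦrip, ← hΨl, hΨrip]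
  · rintro a _ ⟨x, y, rfl⟩
    exact ⟨X.lsmul a x ⊗ₜ y, h.lsmul_map a x y, by simp [h'.lsmul_map, hΦl]⟩
  · rintro s _ ⟨x, y, rfl⟩
    exact ⟨X.act s x ⊗ₜ Y.act s y, h.act_map s x y, by simp [h'.act_map, hΦact, hΨact]⟩

end IsBalancedTensorMap

theorem IsBalancedTensor.exists_map {X : EquivariantBimodule A B} {Y : EquivariantBimodule B C}
    {Z : EquivariantBimodule A C} (h : X.IsBalancedTensor Y Z) :
    ∃ q, IsBalancedTensorMap X Y Z q :=
  let ⟨q, h1, h2, h3, _, h5⟩ := h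
  ⟨q, h1, h2, h3, h5⟩

theorem exists_isBalancedTensor (X : EquivariantBimodule A B) (Y : EquivariantBimodule B C) :
    ∃ Z : EquivariantBimodule A C, X.IsBalancedTensor Y Z := by
  let P := tensorPre X Y
  obtain ⟨K⟩ : Nonempty (HausdorffCompletion P.seminorm) := inferInstance
  let e : X.carrier ⊗[ℂ] Y.carrier →ₗ[ℂ] K.space := K.map
  have he : DenseRange e := K.denseRange
  have hle : ∀ x y, ‖e (x ⊗ₜ y)‖ ≤ ‖x‖ * ‖y‖ := fun x y => by
    refine (K.norm_map _).trans_le ((sq_le_sq₀ (apply_nonneg _ _) (by positivity)).1 ?_)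
    refine (P.seminorm_sq _).trans_le ?_
    change ‖Y.rip y (Y.lsmul (X.rip x x) y)‖ ≤ _
    calc _ ≤ ‖y‖ * ‖Y.lsmul (X.rip x x) y‖ := Y.norm_rip_le _ _
      _ ≤ ‖y‖ * (‖X.rip x x‖ * ‖y‖) := by gcongr; exact Y.norm_lsmul_le _ _
      _ = _ := by rw [← X.norm_sq]; ring
  let b : X.carrier →L[ℂ] Y.carrier →L[ℂ] K.space :=
    ((TensorProduct.mk ℂ X.carrier Y.carrier).compr₂ e).mkContinuous₂ 1 fun x y => by
      simpa using hle x y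
  have hb : ∀ x y, b x y = e (x ⊗ₜ y) := fun _ _ => rfl
  have hbspan : Dense (Submodule.span ℂ {z | ∃ x y, b x y = z} : Set K.space) := by
    have : {z | ∃ x y, b x y = z} = e '' {t | ∃ x y, x ⊗ₜ y = t} := by
      ext z
      simp [hb]
    rw [this, Submodule.span_image, span_tmul_eq_top X Y, ← LinearMap.range_eq_map]
    exact he
  let act : G →* (X.carrier ⊗[ℂ] Y.carrier ≃ₗ[ℂ] X.carrier ⊗[ℂ] Y.carrier) :=
    { toFun := fun s => TensorProduct.congr (X.act s) (Y.act s)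
      map_one' := by
        refine LinearEquiv.toLinearMap_injective (TensorProduct.ext' fun x y => ?_)
        simp
      map_mul' := fun s t => by
        refine LinearEquiv.toLinearMap_injective (TensorProduct.ext' fun x y => ?_)
        simp }
  have hact : ∀ s x y, act s (x ⊗ₜ y) = X.act s x ⊗ₜ Y.act s y := fun _ _ _ => rfl
  have h1 : ∀ s a (t : X.carrier ⊗[ℂ] Y.carrier), act s ((X.lsmul a).rTensor Y.carrier t) =
      (X.lsmul (A.act s a)).rTensor Y.carrier (act s t) := fun s a t => by
    induction t with
    | zero => simp
    | add t t' h h' => simp only [map_add, h, h']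
    | tmul x y => simp [hact, X.act_lsmul]
  have h2 : ∀ s t t', tensorRip X Y (act s t) (act s t') = C.act s (tensorRip X Y t t') :=
    fun s t t' => by
    induction t with
    | zero => simp
    | add t₁ t₂ h h' => simp only [map_add, LinearMap.add_apply, h, h']
    | tmul x y =>
      induction t' with
      | zero => simp
      | add t₁ t₂ h h' => simp only [map_add, h, h']
      | tmul z w =>
        rw [hact, hact, tensorRip_tmul, tensorRip_tmul, X.rip_act, ← Y.act_lsmul, Y.rip_act]
  suffices h : ∃ (Z : EquivariantBimodule A C) (q : P.carrier →ₗ[ℂ] Z.carrier), DenseRange q ∧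
      (∀ s t, Z.rip (q s) (q t) = P.rip s t) ∧
      (∀ a t, Z.lsmul a (q t) = q (P.lsmul a t)) ∧
      (∀ t c, Z.rsmul (q t) c = q (P.rsmul t c)) ∧
      (∀ s t, Z.act s (q t) = q (act s t)) by
    obtain ⟨Z, q, hq, hrip, hl, -, hqact⟩ := h
    exact ⟨Z, (IsBalancedTensorMap.mk (q := q) hq (fun x y z w => hrip _ _)
      (fun a x y => hl _ _) (fun s x y => hqact _ _)).isBalancedTensor⟩
  refine P.exists_completion act h1 h2 ?_ K ?_ (span_tmul_eq_top X Y) ?_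
  · -- `⟨y, ⟨x, z⟩ w⟩` generates `⟨Y, B Y⟩`, and this generates `⟨Y, Y⟩`.
    refine Y.full.span_of_subset_closure ?_
    rintro _ ⟨y, y', rfl⟩
    have hcl := (Submodule.span ℂ
      {c : C.alg | ∃ s t, P.rip s t = c}).isClosed_topologicalClosure
    refine mem_of_dense_span Y.nondegenerate (Y.ripL y) hcl ?_ y'
    rintro _ ⟨b, w, rfl⟩
    refine mem_of_dense_span X.full (Y.ripL y ∘L Y.lsmulL.flip w) hcl ?_ b
    rintro _ ⟨x, z, rfl⟩
    exact Submodule.le_topologicalClosure _ (Submodule.subset_span ⟨x ⊗ₜ y, z ⊗ₜ w, rfl⟩)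
  · refine hbspan.span_of_subset_closure ?_
    rintro _ ⟨x, y, rfl⟩
    refine mem_of_dense_span X.nondegenerate (b.flip y)
      (Submodule.isClosed_topologicalClosure _) ?_ x
    rintro _ ⟨a, x, rfl⟩
    exact Submodule.le_topologicalClosure _ (Submodule.subset_span ⟨a, x ⊗ₜ y, rfl⟩)
  · rintro _ ⟨x, y, rfl⟩
    change Continuous fun s => b (X.act s x) (Y.act s y)
    have h1 := X.continuous_act x
    have h2 := Y.continuous_act y
    fun_prop

end EquivariantBimodule

/-! ### The category laws -/

section

variable {G : Type v} [Group G] [TopologicalSpace G] {A B C D : CStarSystem.{u} G}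

open EquivariantBimodule

/-- `A ⊗_A X ≅ X` through `a ⊗ x ↦ a · x`. -/
theorem EquivariantBimodule.id_isBalancedTensor (X : EquivariantBimodule A B) :
    A.idBimodule.IsBalancedTensor X X := by
  refine (IsBalancedTensorMap.mk (q := TensorProduct.lift X.lsmul) ?_ ?_ ?_ ?_).isBalancedTensor
  · have : (Submodule.span ℂ {z | ∃ a x, X.lsmul a x = z} : Set X.carrier) ⊆
        LinearMap.range (TensorProduct.lift X.lsmul) := by
      refine Submodule.span_le.2 ?_
      rintro _ ⟨a, x, rfl⟩
      exact ⟨a ⊗ₜ x, rfl⟩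
    exact X.nondegenerate.mono this
  · intro a x b y
    change A.alg at a b
    change X.rip (X.lsmul a x) (X.lsmul b y) = X.rip x (X.lsmul (star a * b) y)
    rw [X.rip_lsmul, X.mul_lsmul]
  · intro a b x
    exact (X.mul_lsmul a b x).symm
  · intro s a x
    exact X.act_lsmul s a x

/-- `X ⊗_B B ≅ X` through `x ⊗ b ↦ x · b`. -/
theorem EquivariantBimodule.isBalancedTensor_id (X : EquivariantBimodule A B) :
    X.IsBalancedTensor B.idBimodule X := by
  refine (IsBalancedTensorMap.mk (q := TensorProduct.lift X.rsmul) ?_ ?_ ?_ ?_).isBalancedTensor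
  · have : (Submodule.span ℂ {z | ∃ x b, X.rsmul x b = z} : Set X.carrier) ⊆
        LinearMap.range (TensorProduct.lift X.rsmul) := by
      refine Submodule.span_le.2 ?_
      rintro _ ⟨x, b, rfl⟩
      exact ⟨x ⊗ₜ b, rfl⟩
    exact X.dense_span_rsmul.mono this
  · intro x b y c
    change B.alg at b c
    change X.rip (X.rsmul x b) (X.rsmul y c) = star b * (X.rip x y * c)
    rw [X.rip_rsmul, X.rip_rsmul_left, mul_assoc]
  · intro a x b
    exact X.lsmul_rsmul a x b
  · intro s x b
    exact X.act_rsmul s x b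

/-- Both `(X ⊗ Y) ⊗ Z` and `X ⊗ (Y ⊗ Z)` are completions of `(X ⊙ Y) ⊙ Z` for the same inner
product. -/
theorem EquivariantBimodule.tensor_assoc {X : EquivariantBimodule A B}
    {Y : EquivariantBimodule B C} {Z : EquivariantBimodule C D} {XY : EquivariantBimodule A C}
    {YZ : EquivariantBimodule B D} {L R : EquivariantBimodule A D}
    (hXY : X.IsBalancedTensor Y XY) (hYZ : Y.IsBalancedTensor Z YZ)
    (hL : XY.IsBalancedTensor Z L) (hR : X.IsBalancedTensor YZ R) : L.Isomorphic R := by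
  obtain ⟨p, hp⟩ := hXY.exists_map
  obtain ⟨q, hq⟩ := hYZ.exists_map
  obtain ⟨l, hl⟩ := hL.exists_map
  obtain ⟨r, hr⟩ := hR.exists_map
  have hd1 := hl.denseRange_comp_map hp.denseRange
    (g := (LinearMap.id : Z.carrier →ₗ[ℂ] Z.carrier)) denseRange_id
  have hd2 : DenseRange ((r ∘ₗ TensorProduct.map
      (LinearMap.id : X.carrier →ₗ[ℂ] X.carrier) q) ∘ₗ
      (TensorProduct.assoc ℂ X.carrier Y.carrier Z.carrier).toLinearMap) := by
    have := hr.denseRange_comp_map (f := (LinearMap.id : X.carrier →ₗ[ℂ] X.carrier))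
      denseRange_id hq.denseRange
    rw [DenseRange, LinearMap.coe_comp, LinearEquiv.coe_coe, EquivLike.range_comp]
    exact this
  have hS : Submodule.span ℂ {t | ∃ x y z, (x ⊗ₜ y) ⊗ₜ z = t} =
      (⊤ : Submodule ℂ ((X.carrier ⊗[ℂ] Y.carrier) ⊗[ℂ] Z.carrier)) := by
    refine eq_top_iff.2 fun t _ => ?_
    induction t with
    | zero => exact zero_mem _
    | add t t' h h' => exact add_mem (h trivial) (h' trivial)
    | tmul s z =>
      induction s with
      | zero => simp
      | add s s' h h' => rw [TensorProduct.add_tmul]; exact add_mem (h trivial) (h' trivial)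
      | tmul x y => exact Submodule.subset_span ⟨x, y, z, rfl⟩
  refine isomorphic_of_denseRange L R _ _ hd1 hd2 hS ?_ ?_ ?_
  · rintro _ ⟨x, y, z, rfl⟩ _ ⟨x', y', z', rfl⟩
    simp [hp.rip_map, hq.rip_map, hl.rip_map, hr.rip_map, hq.lsmul_map]
  · rintro a _ ⟨x, y, z, rfl⟩
    refine ⟨(X.lsmul a x ⊗ₜ y) ⊗ₜ z, ?_, ?_⟩
    · simp [hp.lsmul_map, hl.lsmul_map]
    · simp [hr.lsmul_map]
  · rintro s _ ⟨x, y, z, rfl⟩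
    refine ⟨(X.act s x ⊗ₜ Y.act s y) ⊗ₜ Z.act s z, ?_, ?_⟩
    · simp [hp.act_map, hl.act_map]
    · simp [hr.act_map, hq.act_map]

/-- The composition of classes of bimodules: the class of the balanced tensor product. -/
noncomputable def BimoduleClass.comp (f : BimoduleClass A B) (g : BimoduleClass B C) :
    BimoduleClass A C :=
  Quotient.map₂ (fun X Y => (exists_isBalancedTensor X Y).choose)
    (fun X X' hX Y Y' hY => by
      obtain ⟨q, hq⟩ := (exists_isBalancedTensor X Y).choose_spec.exists_map
      obtain ⟨q', hq'⟩ := (exists_isBalancedTensor X' Y').choose_spec.exists_map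
      exact hq.isomorphic hq' hX hY) f g

theorem EquivariantBimodule.cls_eq_iff {X Y : EquivariantBimodule A B} :
    X.cls = Y.cls ↔ X.Isomorphic Y :=
  Quotient.eq

theorem EquivariantBimodule.IsBalancedTensor.comp_cls {X : EquivariantBimodule A B}
    {Y : EquivariantBimodule B C} {Z : EquivariantBimodule A C} (h : X.IsBalancedTensor Y Z) :
    X.cls.comp Y.cls = Z.cls := by
  obtain ⟨q, hq⟩ := (exists_isBalancedTensor X Y).choose_spec.exists_map
  obtain ⟨q', hq'⟩ := h.exists_map
  exact Quotient.sound (hq.isomorphic hq' (Setoid.refl X) (Setoid.refl Y))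

theorem BimoduleClass.id_comp (f : BimoduleClass A B) : A.idBimodule.cls.comp f = f := by
  induction f using Quotient.inductionOn with
  | h X => exact X.id_isBalancedTensor.comp_cls

theorem BimoduleClass.comp_id (f : BimoduleClass A B) : f.comp B.idBimodule.cls = f := by
  induction f using Quotient.inductionOn with
  | h X => exact X.isBalancedTensor_id.comp_cls

theorem BimoduleClass.assoc (f : BimoduleClass A B) (g : BimoduleClass B C)
    (h : BimoduleClass C D) : (f.comp g).comp h = f.comp (g.comp h) := by
  induction f, g, h using Quotient.inductionOn₃ with
  | h X Y Z =>
    obtain ⟨XY, hXY⟩ := exists_isBalancedTensor X Y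
    obtain ⟨YZ, hYZ⟩ := exists_isBalancedTensor Y Z
    obtain ⟨L, hL⟩ := exists_isBalancedTensor XY Z
    obtain ⟨R, hR⟩ := exists_isBalancedTensor X YZ
    change (X.cls.comp Y.cls).comp Z.cls = X.cls.comp (Y.cls.comp Z.cls)
    rw [hXY.comp_cls, hYZ.comp_cls, hL.comp_cls, hR.comp_cls, cls_eq_iff]
    exact tensor_assoc hXY hYZ hL hR

end

/-! ### The dual of an imprimitivity bimodule -/

/-- The complex conjugate of a complex vector space: the same additive group, with `c • x` replaced
by `conj c • x`. -/
def ConjSpace (V : Type*) : Type _ := V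

namespace ConjSpace

variable {V : Type*} [AddCommGroup V] [Module ℂ V]

instance : AddCommGroup (ConjSpace V) := inferInstanceAs (AddCommGroup V)

instance : Module ℂ (ConjSpace V) := Module.compHom V (starRingEnd ℂ)

/-- The identity map from a vector space to its conjugate. -/
def toConj : V ≃ₛₗ[starRingEnd ℂ] ConjSpace V where
  toFun x := x
  invFun x := x
  left_inv _ := rfl
  right_inv _ := rfl
  map_add' _ _ := rfl
  map_smul' c x := by
    change c • x = starRingEnd ℂ (starRingEnd ℂ c) • x
    simp

theorem symm_add (x y : ConjSpace V) :
    toConj.symm (x + y) = toConj.symm x + toConj.symm y := rfl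

theorem symm_smul (c : ℂ) (x : ConjSpace V) :
    toConj.symm (c • x) = starRingEnd ℂ c • toConj.symm x := rfl

theorem toConj_conj_smul (c : ℂ) (x : V) : toConj (starRingEnd ℂ c • x) = c • toConj x := rfl

/-- A linear automorphism of `V`, as a linear automorphism of the conjugate of `V`. -/
def conjEquiv (f : V ≃ₗ[ℂ] V) : ConjSpace V ≃ₗ[ℂ] ConjSpace V where
  toFun x := toConj (f (toConj.symm x))
  invFun x := toConj (f.symm (toConj.symm x))
  left_inv x := by simp
  right_inv x := by simp
  map_add' x y := by rw [symm_add, map_add, map_add]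
  map_smul' c x := by rw [symm_smul, map_smul, toConj_conj_smul, RingHom.id_apply]

end ConjSpace

open ConjSpace

namespace EquivariantBimodule

variable {G : Type v} [Group G] [TopologicalSpace G] {A B : CStarSystem.{u} G}
  {X : EquivariantBimodule A B} {lip : X.carrier → X.carrier → A.alg}

namespace IsFullLeftHilbert

theorem add_right (h : X.IsFullLeftHilbert lip) (x y z) : lip x (y + z) = lip x y + lip x z := by
  rw [← h.star_lip, h.add_left, star_add, h.star_lip, h.star_lip]

theorem smul_right (h : X.IsFullLeftHilbert lip) (c : ℂ) (x y) :
    lip x (c • y) = star c • lip x y := by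
  rw [← h.star_lip, h.smul_left, star_smul, h.star_lip]

theorem lsmul_right (h : X.IsFullLeftHilbert lip) (a x y) :
    lip x (X.lsmul a y) = lip x y * star a := by
  rw [← h.star_lip, h.lsmul_left, star_mul, h.star_lip]

/-- The dual `B`-`A` bimodule `X~` of a bimodule with a left inner product, before completion:
the conjugate space of `X`, with `b · x~ · a = (a* · x · b*)~` and `⟨x~, y~⟩ = lip x y`. -/
noncomputable def dualPre (h : X.IsFullLeftHilbert lip)
    (hb : ∀ x b y, lip (X.rsmul x b) y = lip x (X.rsmul y (star b))) :
    PreHilbertBimodule.{u} B.alg A.alg where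
  carrier := ConjSpace X.carrier
  rsmul := LinearMap.mk₂ ℂ (fun x a => toConj (X.lsmul (star a) (toConj.symm x)))
    (fun x y a => by rw [symm_add, map_add, map_add])
    (fun c x a => by rw [symm_smul, map_smul, toConj_conj_smul])
    (fun x a a' => by rw [star_add, map_add, LinearMap.add_apply, map_add])
    (fun c x a => by
      rw [star_smul, map_smul, LinearMap.smul_apply, ← starRingEnd_apply, toConj_conj_smul])
  lsmul := LinearMap.mk₂ ℂ (fun b x => toConj (X.rsmul (toConj.symm x) (star b)))
    (fun b b' x => by rw [star_add, map_add, map_add])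
    (fun c b x => by rw [star_smul, map_smul, ← starRingEnd_apply, toConj_conj_smul])
    (fun b x y => by rw [symm_add, map_add, LinearMap.add_apply, map_add])
    (fun c b x => by rw [symm_smul, map_smul, LinearMap.smul_apply, toConj_conj_smul])
  rip := LinearMap.mk₂'ₛₗ (starRingEnd ℂ) (RingHom.id ℂ)
    (fun x y => lip (toConj.symm x) (toConj.symm y))
    (fun x y z => by rw [symm_add, h.add_left])
    (fun c x y => by rw [symm_smul, h.smul_left])
    (fun x y z => by rw [symm_add, h.add_right])
    (fun c x y => by
      rw [symm_smul, h.smul_right, starRingEnd_apply, star_star, RingHom.id_apply])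
  rip_rsmul x y a := by simp [h.lsmul_right]
  star_rip x y := h.star_lip _ _
  isPos_rip_self x := h.self_nonneg _
  mul_lsmul b b' x := by simp [X.rsmul_mul]
  rip_lsmul b x y := by simp [hb]

/-- The norm of the left inner product is dominated by the norm of `X`. -/
theorem seminorm_dualPre_le (h : X.IsFullLeftHilbert lip)
    (hl : ∀ x y z, X.lsmul (lip x y) z = X.rsmul x (X.rip y z))
    (hb : ∀ x b y, lip (X.rsmul x b) y = lip x (X.rsmul y (star b))) (x : X.carrier) :
    (h.dualPre hb).seminorm (toConj x) ≤ ‖x‖ := by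
  set P := h.dualPre hb
  set N := P.seminorm (toConj x) with hN
  have hN0 : 0 ≤ N := apply_nonneg _ _
  have hsq : N ^ 2 = ‖lip x x‖ := P.seminorm_sq _
  -- `lip x x * lip x x = lip (x · ⟨x, x⟩) x`
  have h1 : N ^ 2 * N ^ 2 ≤ ‖x‖ ^ 2 * N ^ 2 := by
    calc N ^ 2 * N ^ 2 = ‖lip x x * lip x x‖ := by
          rw [hsq, ← CStarRing.norm_self_mul_star, h.star_lip]
      _ = ‖P.rip (P.lsmul (star (X.rip x x)) (toConj x)) (toConj x)‖ := by
          rw [← h.lsmul_left, hl]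
          change _ = ‖lip (X.rsmul x (star (star (X.rip x x)))) x‖
          rw [star_star]
      _ ≤ P.seminorm (P.lsmul (star (X.rip x x)) (toConj x)) * N := P.norm_rip_le _ _
      _ ≤ (‖star (X.rip x x)‖ * N) * N := by
          gcongr
          exact P.seminorm_lsmul_le _ _
      _ = _ := by rw [norm_star, ← X.norm_sq]; ring
  rcases hN0.eq_or_lt with h0 | h0
  · rw [← h0]
    exact norm_nonneg x
  · exact (sq_le_sq₀ hN0 (norm_nonneg x)).1 (le_of_mul_le_mul_right h1 (by positivity))

end IsFullLeftHilbert

/-- The dual bimodule of an imprimitivity bimodule: the completion of the conjugate space. -/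
theorem exists_dual (h : X.IsFullLeftHilbert lip)
    (hl : ∀ x y z, X.lsmul (lip x y) z = X.rsmul x (X.rip y z))
    (hb : ∀ x b y, lip (X.rsmul x b) y = lip x (X.rsmul y (star b)))
    (hs : ∀ s x y, A.act s (lip x y) = lip (X.act s x) (X.act s y)) :
    ∃ (Y : EquivariantBimodule B A) (q : ConjSpace X.carrier →ₗ[ℂ] Y.carrier), DenseRange q ∧
      (∀ x y, Y.rip (q (toConj x)) (q (toConj y)) = lip x y) ∧
      (∀ b x, Y.lsmul b (q (toConj x)) = q (toConj (X.rsmul x (star b)))) ∧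
      (∀ s x, Y.act s (q (toConj x)) = q (toConj (X.act s x))) := by
  let P := h.dualPre hb
  obtain ⟨K⟩ : Nonempty (HausdorffCompletion P.seminorm) := inferInstance
  let act : G →* (ConjSpace X.carrier ≃ₗ[ℂ] ConjSpace X.carrier) :=
    { toFun := fun s => conjEquiv (X.act s)
      map_one' := by
        ext x
        change toConj (X.act 1 (toConj.symm x)) = x
        simp
      map_mul' := fun s t => by
        ext x
        change toConj (X.act (s * t) (toConj.symm x)) = _
        rw [map_mul]
        rfl }
  -- the canonical map of `X` into the completion of its conjugate space
  let e : X.carrier →L⋆[ℂ] K.space :=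
    (K.map ∘ₛₗ (toConj : X.carrier ≃ₛₗ[starRingEnd ℂ] ConjSpace X.carrier).toLinearMap).mkContinuous
      1 fun x => by
        rw [one_mul]
        exact (K.norm_map _).trans_le (h.seminorm_dualPre_le hl hb x)
  have hsurj : ∀ x : P.carrier, ∃ y : X.carrier, toConj y = x := fun x => ⟨toConj.symm x, rfl⟩
  have hcl : ∀ x, e x ∈ (Submodule.span ℂ
      {z | ∃ b x, K.map (P.lsmul b x) = z}).topologicalClosure := by
    refine mem_of_dense_span X.dense_span_rsmul e (Submodule.isClosed_topologicalClosure _) ?_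
    rintro _ ⟨x, b, rfl⟩
    refine Submodule.le_topologicalClosure _ (Submodule.subset_span ⟨star b, toConj x, ?_⟩)
    change e (X.rsmul x (star (star b))) = _
    rw [star_star]
  obtain ⟨Y, q, hq, hrip, hlq, -, hact⟩ :
      ∃ (Y : EquivariantBimodule B A) (q : P.carrier →ₗ[ℂ] Y.carrier), DenseRange q ∧
      (∀ x y, Y.rip (q x) (q y) = P.rip x y) ∧
      (∀ b x, Y.lsmul b (q x) = q (P.lsmul b x)) ∧
      (∀ x a, Y.rsmul (q x) a = q (P.rsmul x a)) ∧
      (∀ s x, Y.act s (q x) = q (act s x)) := by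
    refine P.exists_completion act ?_ ?_ ?_ K ?_ Submodule.span_univ ?_
    · intro s b x
      obtain ⟨x, rfl⟩ := hsurj x
      change toConj (X.act s (X.rsmul x (star b))) =
        toConj (X.rsmul (X.act s x) (star (B.act s b)))
      rw [X.act_rsmul, map_star]
    · intro s x y
      exact (hs s _ _).symm
    · exact h.full.mono (Submodule.span_mono (by
        rintro _ ⟨x, y, rfl⟩
        exact ⟨toConj x, toConj y, rfl⟩))
    · intro z
      refine K.denseRange.induction_on (p := fun z => z ∈ closure
        (Submodule.span ℂ {z | ∃ b x, K.map (P.lsmul b x) = z} : Set K.space)) z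
        isClosed_closure fun x => ?_
      obtain ⟨x, rfl⟩ := hsurj x
      exact hcl x
    · rintro x -
      obtain ⟨x, rfl⟩ := hsurj x
      exact e.continuous.comp (X.continuous_act x)
  exact ⟨Y, q, hq, fun x y => hrip _ _, fun b x => hlq _ _, fun s x => hact _ _⟩

/-- The class of an equivariant imprimitivity bimodule is invertible; the inverse is the class of
the dual bimodule. The isomorphisms `X ⊗ X~ ≅ A` and `X~ ⊗ X ≅ B` are given by the two inner
products. -/
theorem IsEquivariantImprimitivity.exists_inverse (hX : X.IsEquivariantImprimitivity) :
    ∃ Y : EquivariantBimodule B A, X.cls.comp Y.cls = A.idBimodule.cls ∧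
      Y.cls.comp X.cls = B.idBimodule.cls := by
  obtain ⟨lip, h, hl, hb, hs⟩ := hX
  obtain ⟨Y, q, hq, hrip, hlq, hact⟩ := exists_dual h hl hb hs
  have hsurj : ∀ x : ConjSpace X.carrier, ∃ y : X.carrier, toConj y = x :=
    fun x => ⟨toConj.symm x, rfl⟩
  refine ⟨Y, ?_, ?_⟩
  · obtain ⟨W, hW⟩ := exists_isBalancedTensor X Y
    obtain ⟨w, hw⟩ := hW.exists_map
    rw [hW.comp_cls, cls_eq_iff]
    let lipₗ : X.carrier →ₗ[ℂ] ConjSpace X.carrier →ₗ[ℂ] A.alg :=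
      LinearMap.mk₂ ℂ (fun x y => lip x (toConj.symm y)) (fun x y z => h.add_left x y _)
        (fun c x y => h.smul_left c x _) (fun x y z => h.add_right x _ _)
        (fun c x y => by rw [symm_smul, h.smul_right, starRingEnd_apply, star_star])
    have hlip : ∀ x y, TensorProduct.lift lipₗ (x ⊗ₜ toConj y) = lip x y := fun _ _ => rfl
    refine isomorphic_of_denseRange W A.idBimodule
      (w ∘ₗ TensorProduct.map LinearMap.id q) (TensorProduct.lift lipₗ)
      (hw.denseRange_comp_map denseRange_id hq) ?_
      (TensorProduct.span_tmul_eq_top ℂ X.carrier (ConjSpace X.carrier)) ?_ ?_ ?_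
    · have : (Submodule.span ℂ {a | ∃ x y, lip x y = a} : Set A.alg) ⊆
          (LinearMap.range (TensorProduct.lift lipₗ) : Submodule ℂ A.alg) := by
        refine Submodule.span_le.2 ?_
        rintro _ ⟨x, y, rfl⟩
        exact ⟨x ⊗ₜ toConj y, rfl⟩
      exact h.full.mono this
    · rintro _ ⟨x, y, rfl⟩ _ ⟨z, t, rfl⟩
      obtain ⟨y, rfl⟩ := hsurj y
      obtain ⟨t, rfl⟩ := hsurj t
      simp only [LinearMap.comp_apply, TensorProduct.map_tmul, LinearMap.id_apply, hw.rip_map, hlq,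
        hrip]
      change _ = star (lip x y) * lip z t
      rw [← hb, ← hl, h.lsmul_left, h.star_lip]
    · rintro a _ ⟨x, y, rfl⟩
      obtain ⟨y, rfl⟩ := hsurj y
      exact ⟨X.lsmul a x ⊗ₜ toConj y, by simp [hw.lsmul_map], (h.lsmul_left a x y).symm⟩
    · rintro s _ ⟨x, y, rfl⟩
      obtain ⟨y, rfl⟩ := hsurj y
      exact ⟨X.act s x ⊗ₜ toConj (X.act s y), by simp [hw.act_map, hact], hs s x y⟩
  · obtain ⟨W, hW⟩ := exists_isBalancedTensor Y X
    obtain ⟨w, hw⟩ := hW.exists_map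
    rw [hW.comp_cls, cls_eq_iff]
    let ripₗ : ConjSpace X.carrier →ₗ[ℂ] X.carrier →ₗ[ℂ] B.alg :=
      LinearMap.mk₂ ℂ (fun x y => X.rip (toConj.symm x) y)
        (fun x y z => LinearMap.map_add₂ _ _ _ _)
        (fun c x y => by
          rw [symm_smul, map_smulₛₗ, LinearMap.smul_apply, starRingEnd_self_apply])
        (fun x y z => map_add _ _ _) (fun c x y => map_smul _ _ _)
    refine isomorphic_of_denseRange W B.idBimodule
      (w ∘ₗ TensorProduct.map q LinearMap.id) (TensorProduct.lift ripₗ)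
      (hw.denseRange_comp_map hq denseRange_id) ?_
      (TensorProduct.span_tmul_eq_top ℂ (ConjSpace X.carrier) X.carrier) ?_ ?_ ?_
    · have : (Submodule.span ℂ {b | ∃ x y, X.rip x y = b} : Set B.alg) ⊆
          (LinearMap.range (TensorProduct.lift ripₗ) : Submodule ℂ B.alg) := by
        refine Submodule.span_le.2 ?_
        rintro _ ⟨x, y, rfl⟩
        exact ⟨toConj x ⊗ₜ y, rfl⟩
      exact X.full.mono this
    · rintro _ ⟨x, y, rfl⟩ _ ⟨z, t, rfl⟩
      obtain ⟨x, rfl⟩ := hsurj x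
      obtain ⟨z, rfl⟩ := hsurj z
      simp only [LinearMap.comp_apply, TensorProduct.map_tmul, LinearMap.id_apply, hw.rip_map,
        hrip]
      change _ = star (X.rip x y) * X.rip z t
      rw [hl, X.rip_rsmul, X.star_rip]
    · rintro b _ ⟨x, y, rfl⟩
      obtain ⟨x, rfl⟩ := hsurj x
      refine ⟨toConj (X.rsmul x (star b)) ⊗ₜ y, by simp [hw.lsmul_map, hlq], ?_⟩
      change b * X.rip x y = X.rip (X.rsmul x (star b)) y
      rw [X.rip_rsmul_left, star_star]
    · rintro s _ ⟨x, y, rfl⟩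
      obtain ⟨x, rfl⟩ := hsurj x
      exact ⟨toConj (X.act s x) ⊗ₜ X.act s y, by simp [hw.act_map, hact], (X.rip_act s x y).symm⟩

end EquivariantBimodule

/-! ### Adjointable operators -/

namespace RightHilbertBimodule

variable {A B : Type u} [NonUnitalCStarAlgebra A] [NonUnitalCStarAlgebra B]
  (X : RightHilbertBimodule A B)

/-- The bounded operators `T` on the Hilbert module `X` that have an adjoint `S`, which means
`⟨T x, y⟩ = ⟨x, S y⟩`. -/
def adjointable : Subalgebra ℂ (X.carrier →L[ℂ] X.carrier) where
  carrier := {T | ∃ S : X.carrier →L[ℂ] X.carrier, ∀ x y, X.rip (T x) y = X.rip x (S y)}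
  mul_mem' := by
    rintro T T' ⟨S, hS⟩ ⟨S', hS'⟩
    refine ⟨S' * S, fun x y => ?_⟩
    change X.rip (T (T' x)) y = X.rip x (S' (S y))
    rw [hS, hS']
  add_mem' := by
    rintro T T' ⟨S, hS⟩ ⟨S', hS'⟩
    refine ⟨S + S', fun x y => ?_⟩
    change X.rip (T x + T' x) y = X.rip x (S y + S' y)
    rw [map_add, map_add, LinearMap.add_apply, hS, hS']
  algebraMap_mem' c := ⟨star c • ContinuousLinearMap.id ℂ X.carrier, fun x y => by
    change X.rip (c • x) y = X.rip x (star c • y)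
    simp⟩

/-- The algebra of adjointable operators on the Hilbert module `X`. -/
abbrev Adj : Type u := X.adjointable

variable {X}

namespace Adj

/-- The operator that underlies an element of `Adj X`. -/
def op (T : Adj X) : X.carrier →L[ℂ] X.carrier := T.1

/-- The adjoint of an element of `Adj X`, as an operator. -/
noncomputable def adj (T : Adj X) : X.carrier →L[ℂ] X.carrier := T.2.choose

theorem rip_op (T : Adj X) (x y : X.carrier) : X.rip (T.op x) y = X.rip x (T.adj y) :=
  T.2.choose_spec x y

theorem rip_adj (T : Adj X) (x y : X.carrier) : X.rip (T.adj x) y = X.rip x (T.op y) := by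
  rw [← X.star_rip, ← rip_op, X.star_rip]

/-- An operator `S` with adjoint `T`, as an element of `Adj X`. -/
def mk (S T : X.carrier →L[ℂ] X.carrier) (h : ∀ x y, X.rip (S x) y = X.rip x (T y)) : Adj X :=
  ⟨S, T, h⟩

@[simp] theorem op_mk (S T : X.carrier →L[ℂ] X.carrier) (h) : (mk S T h).op = S := rfl

@[simp] theorem op_mul (S T : Adj X) (x : X.carrier) : (S * T).op x = S.op (T.op x) := rfl

@[simp] theorem op_add (S T : Adj X) : (S + T).op = S.op + T.op := rfl

@[simp] theorem op_sub (S T : Adj X) : (S - T).op = S.op - T.op := rfl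

@[simp] theorem op_zero : (0 : Adj X).op = 0 := rfl

@[simp] theorem op_smul (c : ℂ) (T : Adj X) : (c • T).op = c • T.op := rfl

theorem ext_op {S T : Adj X} (h : ∀ x, S.op x = T.op x) : S = T :=
  Subtype.ext (ContinuousLinearMap.ext h)

noncomputable instance : Star (Adj X) where
  star T := mk T.adj T.op T.rip_adj

theorem rip_op_star (T : Adj X) (x y : X.carrier) :
    X.rip x ((star T).op y) = X.rip (T.op x) y := (T.rip_op x y).symm

theorem star_eq_of_rip {S T : Adj X} (h : ∀ x y, X.rip (T.op x) y = X.rip x (S.op y)) :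
    star T = S :=
  ext_op fun y => X.ext_rip fun x => by rw [rip_op_star, h]

noncomputable instance : StarRing (Adj X) where
  star_involutive T := star_eq_of_rip T.rip_adj
  star_mul S T := star_eq_of_rip fun x y => by simp [rip_op_star]
  star_add S T := star_eq_of_rip fun x y => by simp [rip_op_star]

instance : StarModule ℂ (Adj X) where
  star_smul c T := star_eq_of_rip fun x y => by simp [rip_op_star]

theorem norm_eq (T : Adj X) : ‖T‖ = ‖T.op‖ := rfl

theorem norm_sq_le (T : Adj X) : ‖T‖ ^ 2 ≤ ‖star T * T‖ := by
  have h : ‖T.op‖ ≤ √‖star T * T‖ := by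
    refine ContinuousLinearMap.opNorm_le_bound _ (Real.sqrt_nonneg _) fun x => ?_
    refine (sq_le_sq₀ (norm_nonneg _) (by positivity)).1 ?_
    have h0 : √‖star T * T‖ ^ 2 = ‖star T * T‖ := Real.sq_sqrt (norm_nonneg _)
    rw [mul_pow, h0, X.norm_sq, rip_op]
    calc ‖X.rip x ((star T * T).op x)‖ ≤ ‖x‖ * (‖star T * T‖ * ‖x‖) :=
          (X.norm_rip_le _ _).trans (by gcongr; exact ContinuousLinearMap.le_opNorm _ _)
      _ = _ := by ring
  calc ‖T‖ ^ 2 ≤ √‖star T * T‖ ^ 2 := by gcongr; exact h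
    _ = _ := Real.sq_sqrt (norm_nonneg _)

instance : CStarRing (Adj X) where
  norm_mul_self_le T := by
    rw [← sq]
    exact T.norm_sq_le

/-- Taking adjoints is isometric, so the adjoints of a Cauchy sequence of operators converge along
with the operators. -/
instance : CompleteSpace (Adj X) := by
  refine Metric.complete_of_cauchySeq_tendsto fun u hu => ?_
  have hop : Isometry (op : Adj X → X.carrier →L[ℂ] X.carrier) := isometry_subtype_coe
  obtain ⟨S, hS⟩ := cauchySeq_tendsto_of_complete (hop.uniformContinuous.comp_cauchySeq hu)
  obtain ⟨T, hT⟩ := cauchySeq_tendsto_of_complete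
    ((hop.comp (star_isometry (E := Adj X))).uniformContinuous.comp_cauchySeq hu)
  have h : ∀ x y, X.rip (S x) y = X.rip x (T y) := fun x y => by
    have h1 : Filter.Tendsto (fun n => X.ripL ((u n).op x) y) Filter.atTop
        (nhds (X.ripL (S x) y)) :=
      ((by fun_prop : Continuous fun R : X.carrier →L[ℂ] X.carrier =>
        X.ripL (R x) y).tendsto S).comp hS
    have h2 : Filter.Tendsto (fun n => X.ripL x ((star (u n)).op y)) Filter.atTop
        (nhds (X.ripL x (T y))) :=
      ((by fun_prop : Continuous fun R : X.carrier →L[ℂ] X.carrier =>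
        X.ripL x (R y)).tendsto T).comp hT
    exact tendsto_nhds_unique h1 (h2.congr fun n => (u n).rip_op_star x y)
  exact ⟨mk S T h, tendsto_subtype_rng.2 hS⟩

/-- The adjointable operators on a Hilbert module form a C*-algebra. -/
noncomputable instance : CStarAlgebra (Adj X) where

end Adj

variable (X)

/-- The rank one operator `θ_{x,y}`, `z ↦ x · ⟨y, z⟩`. -/
noncomputable def rankOne : X.carrier →L[ℂ] X.carrier →L⋆[ℂ] Adj X :=
  LinearMap.mkContinuous₂
    (LinearMap.mk₂'ₛₗ (RingHom.id ℂ) (starRingEnd ℂ)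
      (fun x y => Adj.mk (X.rsmulL x ∘L X.ripL y) (X.rsmulL y ∘L X.ripL x) fun z w => by
        simp [X.rip_rsmul, X.rip_rsmul_left, X.star_rip])
      (fun x x' y => Adj.ext_op fun z => by simp)
      (fun c x y => Adj.ext_op fun z => by simp)
      (fun x y y' => Adj.ext_op fun z => by simp)
      (fun c x y => Adj.ext_op fun z => by simp))
    1 fun x y => by
      rw [one_mul, Adj.norm_eq]
      refine ContinuousLinearMap.opNorm_le_bound _ (by positivity) fun z => ?_
      calc ‖X.rsmul x (X.rip y z)‖ ≤ ‖x‖ * (‖y‖ * ‖z‖) :=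
            (X.norm_rsmul_le _ _).trans (by gcongr; exact X.norm_rip_le _ _)
        _ = _ := by ring

@[simp] theorem op_rankOne (x y z : X.carrier) :
    (X.rankOne x y).op z = X.rsmul x (X.rip y z) := rfl

theorem star_rankOne (x y : X.carrier) : star (X.rankOne x y) = X.rankOne y x :=
  Adj.star_eq_of_rip fun z w => by simp [X.rip_rsmul, X.rip_rsmul_left, X.star_rip]

theorem mul_rankOne (T : Adj X) (x y : X.carrier) : T * X.rankOne x y = X.rankOne (T.op x) y := by
  refine Adj.ext_op fun z => X.ext_rip fun w => ?_
  rw [Adj.op_mul, op_rankOne, op_rankOne, ← Adj.rip_adj, X.rip_rsmul, X.rip_rsmul, Adj.rip_adj]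

theorem norm_rankOne_self (x : X.carrier) : ‖X.rankOne x x‖ = ‖x‖ ^ 2 := by
  have hle : ‖x‖ ^ 2 * ‖x‖ ^ 2 ≤ ‖X.rankOne x x‖ * ‖x‖ ^ 2 := by
    calc ‖x‖ ^ 2 * ‖x‖ ^ 2 = ‖X.rip x x * X.rip x x‖ := by
          rw [X.norm_sq, ← CStarRing.norm_self_mul_star, X.star_rip]
      _ = ‖X.rip x ((X.rankOne x x).op x)‖ := by rw [op_rankOne, X.rip_rsmul]
      _ ≤ ‖x‖ * (‖X.rankOne x x‖ * ‖x‖) := (X.norm_rip_le _ _).trans (by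
          gcongr
          rw [Adj.norm_eq]
          exact ContinuousLinearMap.le_opNorm _ _)
      _ = _ := by ring
  refine le_antisymm ?_ ?_
  · rw [Adj.norm_eq]
    refine ContinuousLinearMap.opNorm_le_bound _ (by positivity) fun z => ?_
    calc ‖X.rsmul x (X.rip x z)‖ ≤ ‖x‖ * (‖x‖ * ‖z‖) :=
          (X.norm_rsmul_le _ _).trans (by gcongr; exact X.norm_rip_le _ _)
      _ = _ := by ring
  · rcases (norm_nonneg x).eq_or_lt with h | h
    · rw [← h]
      simp
    · exact le_of_mul_le_mul_right hle (by positivity)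

/-- The representation of `A` by adjointable operators on `X`. -/
noncomputable def toAdj : A →⋆ₙₐ[ℂ] Adj X where
  toFun a := Adj.mk (X.lsmulL a) (X.lsmulL (star a)) (X.rip_lsmul a)
  map_smul' c a := Adj.ext_op fun x => LinearMap.map_smul₂ X.lsmul c a x
  map_zero' := Adj.ext_op fun x => LinearMap.map_zero₂ X.lsmul x
  map_add' a b := Adj.ext_op fun x => LinearMap.map_add₂ X.lsmul a b x
  map_mul' a b := Adj.ext_op fun x => X.mul_lsmul a b x
  map_star' a := (Adj.star_eq_of_rip (X.rip_lsmul a)).symm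

@[simp] theorem op_toAdj (a : A) (x : X.carrier) : (X.toAdj a).op x = X.lsmul a x := rfl

/-- The left action is faithful. -/
def IsFaithful : Prop := ∀ a, (∀ x, X.lsmul a x = 0) → a = 0

variable {X}

theorem IsFaithful.ext (h : X.IsFaithful) {a b : A} (hab : ∀ x, X.lsmul a x = X.lsmul b x) :
    a = b :=
  sub_eq_zero.1 (h _ fun x => by rw [map_sub, LinearMap.sub_apply, hab, sub_self])

theorem IsFaithful.injective_toAdj (h : X.IsFaithful) : Function.Injective X.toAdj :=
  fun a b hab => h.ext fun x => by rw [← op_toAdj, hab, op_toAdj]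

theorem IsFaithful.norm_toAdj (h : X.IsFaithful) (a : A) : ‖X.toAdj a‖ = ‖a‖ :=
  NonUnitalStarAlgHom.norm_map X.toAdj h.injective_toAdj a

end RightHilbertBimodule

/-! ### Imprimitivity bimodules and compact operators -/

namespace EquivariantBimodule

variable {G : Type v} [Group G] [TopologicalSpace G] {A B C : CStarSystem.{u} G}

/-- A bimodule is an equivariant imprimitivity bimodule if the left action is faithful and
identifies the left algebra with the compact operators, the closed span of the rank one
operators. -/
theorem isEquivariantImprimitivity_of_lsmul_eq {X : EquivariantBimodule A B}
    (hX : X.IsFaithful) (lip : X.carrier → X.carrier → A.alg)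
    (hlip : ∀ x y z, X.lsmul (lip x y) z = X.rsmul x (X.rip y z))
    (hfull : Dense (Submodule.span ℂ {a | ∃ x y, lip x y = a} : Set A.alg)) :
    X.IsEquivariantImprimitivity := by
  have hrank : ∀ x y, X.toAdj (lip x y) = X.rankOne x y := fun x y =>
    RightHilbertBimodule.Adj.ext_op fun z => hlip x y z
  have hinj := hX.injective_toAdj
  have hstar : ∀ x y, star (lip x y) = lip y x := fun x y => hinj (by
    rw [map_star, hrank, hrank, X.star_rankOne])
  have hnorm : ∀ x, √‖lip x x‖ = ‖x‖ := fun x => by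
    rw [← hX.norm_toAdj, hrank, X.norm_rankOne_self, Real.sqrt_sq (norm_nonneg _)]
  refine ⟨lip, ⟨fun x y z => ?_, fun c x y => ?_, fun a x y => ?_, hstar, fun x => ?_,
    fun x h => ?_, fun f hf => ?_, hfull⟩, hlip, fun x b y => ?_, fun s x y => ?_⟩
  · exact hX.ext fun w => by simp [hlip]
  · exact hX.ext fun w => by simp [hlip]
  · exact hX.ext fun w => by rw [hlip, X.mul_lsmul, hlip, X.lsmul_rsmul]
  · obtain ⟨n, s, hns, hs⟩ := exists_compression_neg (a := lip x x) (hstar x x)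
    refine hs (hX s fun z => X.eq_zero_of_rip_self ?_)
    -- `⟨sz, sz⟩ = -⟨nz, x⟩⟨x, nz⟩` is both positive and negative.
    have h1 : X.rip (X.lsmul s z) (X.lsmul s z) =
        -(star (X.rip x (X.lsmul n z)) * X.rip x (X.lsmul n z)) := by
      rw [X.rip_lsmul, ← X.mul_lsmul, ← neg_neg (star s * s), ← hns, map_neg,
        LinearMap.neg_apply, map_neg, X.mul_lsmul, X.mul_lsmul, hlip, ← X.rip_lsmul,
        X.rip_rsmul, X.star_rip]
    have h2 := IsPos.norm_le (b := 0) (X.rip_self_nonneg (X.lsmul s z))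
      ⟨X.rip x (X.lsmul n z), by rw [h1, zero_sub, neg_neg]⟩
    simpa using h2
  · rw [← norm_eq_zero, ← hnorm, h, norm_zero, Real.sqrt_zero]
  · simp only [hnorm, ← dist_eq_norm] at hf ⊢
    obtain ⟨x, hx⟩ := cauchySeq_tendsto_of_complete (Metric.cauchySeq_iff.2 hf)
    exact ⟨x, Metric.tendsto_atTop.1 hx⟩
  · refine hX.ext fun w => ?_
    rw [hlip, hlip, X.rip_rsmul_left, star_star, X.rsmul_mul]
  · refine hX.ext fun w => ?_
    obtain ⟨w, rfl⟩ : ∃ z, X.act s z = w := ⟨X.act s⁻¹ w, X.act_act_inv s w⟩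
    rw [← X.act_lsmul, hlip, hlip, X.rip_act, X.act_rsmul]

/-- The left action of `A` on `X ⊗_B Y` is faithful only if the left action on `X` is, and `A` acts
faithfully on itself. -/
theorem isFaithful_of_isBalancedTensor_id {X : EquivariantBimodule A B}
    {Y : EquivariantBimodule B A} (h : X.IsBalancedTensor Y A.idBimodule) : X.IsFaithful := by
  obtain ⟨q, hq⟩ := h.exists_map
  intro a ha
  change A.alg at a
  have h1 := mem_of_dense_span hq.dense_span_tmul (A.idBimodule.lsmulL a) (M := ⊥)
    (by simp) (by
      rintro _ ⟨x, y, rfl⟩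
      simp [hq.lsmul_map, ha])
  have h2 : a * (star a : A.alg) = 0 := h1 (star a : A.alg)
  exact (CStarRing.mul_star_self_eq_zero_iff a).1 h2

/-- If `X ⊗_B Y ≅ A` and `B` acts faithfully on `Y`, then `A` acts on `X` as the algebra of compact
operators. For `a = (u ⊗ v)*` in `A`, the operator `a · θ_{x,x'}` on `X` is given by
`(x' · ⟨x, u⟩ ⊗ v)* ∈ A`. As `A` is closed in the adjointable operators and `A · X` is total, all
`θ_{x,x'}` come from `A`. They span a right ideal of `A` which contains the images of the vectors
`x · ⟨x', z⟩ ⊗ y`, and these are total in `A`. -/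
theorem isEquivariantImprimitivity_of_isBalancedTensor_id {X : EquivariantBimodule A B}
    {Y : EquivariantBimodule B A} (h : X.IsBalancedTensor Y A.idBimodule)
    (hY : Y.IsFaithful) : X.IsEquivariantImprimitivity := by
  have hX : X.IsFaithful := isFaithful_of_isBalancedTensor_id h
  obtain ⟨q', hq⟩ := h.exists_map
  let q : X.carrier ⊗[ℂ] Y.carrier →ₗ[ℂ] A.alg := q'
  have hrip : ∀ x y z w, star (q (x ⊗ₜ y)) * q (z ⊗ₜ w) = Y.rip y (Y.lsmul (X.rip x z) w) :=
    hq.rip_map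
  have hmul : ∀ a x y, a * q (x ⊗ₜ y) = q (X.lsmul a x ⊗ₜ y) := hq.lsmul_map
  have hdense : Dense (Submodule.span ℂ {a | ∃ x y, q (x ⊗ₜ y) = a} : Set A.alg) :=
    hq.dense_span_tmul
  -- `X` is separated by `q`
  have hsep : ∀ x x', (∀ y, q (x ⊗ₜ y) = q (x' ⊗ₜ y)) → x = x' := by
    intro x x' hxx'
    rw [← sub_eq_zero]
    refine X.eq_zero_of_rip_self (hY _ fun y => Y.ext_rip fun z => ?_)
    rw [← hrip, TensorProduct.sub_tmul, TensorProduct.sub_tmul, map_sub, map_sub, hxx' y]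
    simp
  have hclosed : IsClosed (LinearMap.range (X.toAdj : A.alg →ₗ[ℂ] X.Adj) : Set X.Adj) := by
    have : Isometry X.toAdj := AddMonoidHomClass.isometry_of_norm _ hX.norm_toAdj
    exact this.isClosedEmbedding.isClosed_range
  have hgen : ∀ u v x x', X.toAdj (star (q (X.rsmul x' (X.rip x u) ⊗ₜ v))) =
      X.rankOne (X.lsmul (star (q (u ⊗ₜ v))) x) x' := by
    intro u v x x'
    refine RightHilbertBimodule.Adj.ext_op fun z => hsep _ _ fun y => ?_
    rw [X.op_toAdj, X.op_rankOne, ← hmul, hrip, ← X.lsmul_rsmul, ← hmul, hrip, X.rip_rsmul,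
      X.rip_rsmul_left, X.star_rip]
  have hmem : ∀ x x', X.rankOne x x' ∈ LinearMap.range (X.toAdj : A.alg →ₗ[ℂ] X.Adj) := by
    intro x x'
    refine mem_of_dense_span X.nondegenerate (X.rankOne.flip x') hclosed ?_ x
    rintro _ ⟨a, x, rfl⟩
    have h1 := mem_of_dense_span (σ := starRingEnd ℂ) hdense
      ((X.rankOne.flip x' ∘L X.lsmulL.flip x).comp (starL ℂ (A := A.alg)).toContinuousLinearMap)
      hclosed (by
        rintro _ ⟨u, v, rfl⟩
        exact ⟨_, hgen u v x x'⟩) (star a)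
    simpa using h1
  choose lip hlip using hmem
  have hlip' : ∀ x y z, X.lsmul (lip x y) z = X.rsmul x (X.rip y z) := fun x y z => by
    rw [← X.op_toAdj, ← X.op_rankOne, ← hlip x y]
    rfl
  refine isEquivariantImprimitivity_of_lsmul_eq hX lip hlip' ?_
  have hcl := (Submodule.span ℂ {a | ∃ x y, lip x y = a}).isClosed_topologicalClosure
  -- the closed span of the values of `lip` is a right ideal
  have hideal : ∀ x x' a, lip x x' * a ∈
      (Submodule.span ℂ {a | ∃ x y, lip x y = a}).topologicalClosure := by
    intro x x' a
    refine Submodule.le_topologicalClosure _ (Submodule.subset_span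
      ⟨x, X.lsmul (star a) x', hX.ext fun z => ?_⟩)
    rw [X.mul_lsmul, hlip', hlip', X.rip_lsmul, star_star]
  refine hdense.span_of_subset_closure ?_
  rintro _ ⟨x, y, rfl⟩
  refine mem_of_dense_span X.dense_span_rsmul (hq.tmulL.flip y) hcl ?_ x
  rintro _ ⟨x, b, rfl⟩
  refine mem_of_dense_span X.full (hq.tmulL.flip y ∘L X.rsmulL x) hcl ?_ b
  rintro _ ⟨x', z, rfl⟩
  change q (X.rsmul x (X.rip x' z) ⊗ₜ y) ∈ _
  rw [← hlip', ← hmul]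
  exact hideal _ _ _

end EquivariantBimodule

/-! ### The algebra of compact operators -/

namespace RightHilbertBimodule

variable {A B : Type u} [NonUnitalCStarAlgebra A] [NonUnitalCStarAlgebra B]
  (X : RightHilbertBimodule A B)

theorem continuous_rankOne : Continuous fun p : X.carrier × X.carrier => X.rankOne p.1 p.2 := by
  refine continuous_iff_continuousAt.2 fun p => tendsto_iff_norm_sub_tendsto_zero.2 ?_
  have h : Continuous fun r : X.carrier × X.carrier =>
      ‖X.rankOne‖ * ‖r.1‖ * ‖r.2 - p.2‖ + ‖X.rankOne‖ * ‖r.1 - p.1‖ * ‖p.2‖ := by fun_prop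
  refine squeeze_zero (fun _ => norm_nonneg _) (fun r => ?_) (h.tendsto' p 0 (by simp))
  have h1 : X.rankOne r.1 r.2 - X.rankOne p.1 p.2 =
      X.rankOne r.1 (r.2 - p.2) + X.rankOne (r.1 - p.1) p.2 := by simp
  rw [h1]
  exact norm_add_le_of_le (X.rankOne.le_opNorm₂ _ _) (X.rankOne.le_opNorm₂ _ _)

/-- The closed span of the rank one operators. -/
noncomputable def compactSubmodule : Submodule ℂ (Adj X) :=
  (Submodule.span ℂ {T | ∃ x y, X.rankOne x y = T}).topologicalClosure

theorem rankOne_mem (x y : X.carrier) : X.rankOne x y ∈ X.compactSubmodule :=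
  Submodule.le_topologicalClosure _ (Submodule.subset_span ⟨x, y, rfl⟩)

theorem isClosed_compactSubmodule : IsClosed (X.compactSubmodule : Set (Adj X)) :=
  Submodule.isClosed_topologicalClosure _

variable {X} in
/-- A continuous linear map which sends the rank one operators to compact operators preserves the
compact operators. -/
theorem map_mem_compactSubmodule {σ : ℂ →+* ℂ} (f : Adj X →SL[σ] Adj X)
    (h : ∀ x y, f (X.rankOne x y) ∈ X.compactSubmodule) {T : Adj X}
    (hT : T ∈ X.compactSubmodule) : f T ∈ X.compactSubmodule := by
  have h1 : Submodule.span ℂ {T | ∃ x y, X.rankOne x y = T} ≤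
      X.compactSubmodule.comap f.toLinearMap := by
    refine Submodule.span_le.2 ?_
    rintro _ ⟨x, y, rfl⟩
    exact h x y
  exact closure_minimal (t := f ⁻¹' (X.compactSubmodule : Set (Adj X))) h1
    (X.isClosed_compactSubmodule.preimage f.continuous) hT

variable {X} in
theorem mul_mem_compactSubmodule_left (S : Adj X) {T : Adj X} (hT : T ∈ X.compactSubmodule) :
    S * T ∈ X.compactSubmodule :=
  map_mem_compactSubmodule (ContinuousLinearMap.mul ℂ (Adj X) S) (fun x y => by
    rw [ContinuousLinearMap.mul_apply', mul_rankOne]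
    exact X.rankOne_mem _ _) hT

variable {X} in
theorem star_mem_compactSubmodule {T : Adj X} (hT : T ∈ X.compactSubmodule) :
    star T ∈ X.compactSubmodule :=
  map_mem_compactSubmodule (starL ℂ (A := Adj X)).toContinuousLinearMap (fun x y => by
    change star (X.rankOne x y) ∈ _
    rw [star_rankOne]
    exact X.rankOne_mem _ _) hT

variable {X} in
theorem mul_mem_compactSubmodule_right (S : Adj X) {T : Adj X} (hT : T ∈ X.compactSubmodule) :
    T * S ∈ X.compactSubmodule := by
  rw [← star_star (T * S), star_mul]
  exact star_mem_compactSubmodule (mul_mem_compactSubmodule_left _ (star_mem_compactSubmodule hT))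

/-- The C*-algebra of compact operators on the Hilbert module `X`. -/
noncomputable def compacts : NonUnitalStarSubalgebra ℂ (Adj X) where
  __ := X.compactSubmodule
  mul_mem' {S _} _ hT := mul_mem_compactSubmodule_left S hT
  star_mem' hT := star_mem_compactSubmodule hT

instance : IsClosed (X.compacts : Set (Adj X)) := X.isClosed_compactSubmodule

noncomputable instance : NonUnitalCStarAlgebra X.compacts :=
  NonUnitalStarSubalgebra.nonUnitalCStarAlgebra X.compacts


/-- The rank one operators as compact operators. -/
noncomputable def compactRankOne (x y : X.carrier) : X.compacts :=
  ⟨X.rankOne x y, X.rankOne_mem x y⟩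

theorem continuous_compactRankOne_left (y : X.carrier) :
    Continuous fun x => X.compactRankOne x y :=
  Continuous.subtype_mk (X.rankOne.flip y).continuous _

theorem dense_span_compactRankOne :
    Dense (Submodule.span ℂ {T | ∃ x y, X.compactRankOne x y = T} : Set X.compacts) := by
  intro T
  rw [closure_subtype]
  have h : ((↑) : X.compacts → Adj X) ''
      (Submodule.span ℂ {T | ∃ x y, X.compactRankOne x y = T} : Set X.compacts) =
      (Submodule.span ℂ {T | ∃ x y, X.rankOne x y = T} : Set (Adj X)) := by
    let i : X.compacts →ₗ[ℂ] Adj X :=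
      { toFun := (↑)
        map_add' := fun _ _ => rfl
        map_smul' := fun _ _ => rfl }
    have h1 : i '' {T | ∃ x y, X.compactRankOne x y = T} = {T | ∃ x y, X.rankOne x y = T} := by
      ext T
      constructor
      · rintro ⟨_, ⟨x, y, rfl⟩, rfl⟩
        exact ⟨x, y, rfl⟩
      · rintro ⟨x, y, rfl⟩
        exact ⟨_, ⟨x, y, rfl⟩, rfl⟩
    rw [← h1, Submodule.span_image]
    rfl
  rw [h]
  exact T.2

/-- An adjointable operator, as a multiplier of the algebra of compact operators. -/
noncomputable def toMultiplier (S : Adj X) : 𝓜(ℂ, X.compacts) where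
  fst := LinearMap.mkContinuous
    { toFun := fun T => ⟨S * T, mul_mem_compactSubmodule_left S T.2⟩
      map_add' := fun T T' => Subtype.ext (mul_add S T.1 T'.1)
      map_smul' := fun c T => Subtype.ext (mul_smul_comm c S T.1) }
    ‖S‖ fun T => norm_mul_le S T.1
  snd := LinearMap.mkContinuous
    { toFun := fun T => ⟨T * S, mul_mem_compactSubmodule_right S T.2⟩
      map_add' := fun T T' => Subtype.ext (add_mul T.1 T'.1 S)
      map_smul' := fun c T => Subtype.ext (smul_mul_assoc c T.1 S) }
    ‖S‖ fun T => (norm_mul_le T.1 S).trans_eq (mul_comm _ _)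
  central T T' := Subtype.ext (mul_assoc T.1 S T'.1)

variable {X} in
theorem multiplier_ext {m m' : 𝓜(ℂ, X.compacts)}
    (h1 : ∀ T, ((m.fst T : X.compacts) : Adj X) = (m'.fst T : X.compacts))
    (h2 : ∀ T, ((m.snd T : X.compacts) : Adj X) = (m'.snd T : X.compacts)) : m = m' :=
  DoubleCentralizer.ext _ _ _ _ (Prod.ext (ContinuousLinearMap.ext fun T => Subtype.ext (h1 T))
    (ContinuousLinearMap.ext fun T => Subtype.ext (h2 T)))

/-- The homomorphism of the adjointable operators into the multipliers of the compact
operators. -/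
noncomputable def toMultiplierHom : Adj X →⋆ₙₐ[ℂ] 𝓜(ℂ, X.compacts) where
  toFun := X.toMultiplier
  map_smul' c S := multiplier_ext (fun T => smul_mul_assoc c S T.1)
    (fun T => mul_smul_comm c T.1 S)
  map_zero' := multiplier_ext (fun T => zero_mul T.1) (fun T => mul_zero T.1)
  map_add' S S' := multiplier_ext (fun T => add_mul S S' T.1) (fun T => mul_add T.1 S S')
  map_mul' S S' := multiplier_ext (fun T => mul_assoc S S' T.1)
    (fun T => (mul_assoc T.1 S S').symm)
  map_star' S := multiplier_ext
    (fun T => by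
      change star S * T.1 = star (star T.1 * S)
      rw [star_mul, star_star])
    (fun T => by
      change T.1 * star S = star (S * star T.1)
      rw [star_mul, star_star])

end RightHilbertBimodule

namespace EquivariantBimodule

open RightHilbertBimodule

variable {G : Type v} [Group G] [TopologicalSpace G] {A B : CStarSystem.{u} G}
  (X : EquivariantBimodule A B)

theorem rip_act_left (s : G) (x y : X.carrier) :
    X.rip (X.act s x) y = B.act s (X.rip x (X.act s⁻¹ y)) := by
  rw [← X.rip_act, X.act_act_inv]

/-- Conjugation `T ↦ γ_s T γ_s⁻¹` of adjointable operators. -/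
noncomputable def conj (s : G) :
    Adj X.toRightHilbertBimodule →⋆ₙₐ[ℂ] Adj X.toRightHilbertBimodule where
  toFun T := Adj.mk (X.actL s ∘L T.op ∘L X.actL s⁻¹) (X.actL s ∘L T.adj ∘L X.actL s⁻¹)
    fun x y => by
      obtain ⟨x, rfl⟩ : ∃ z, X.act s z = x := ⟨_, X.act_act_inv s x⟩
      simp [X.rip_act_left, Adj.rip_op]
  map_smul' c T := Adj.ext_op fun x => by simp
  map_zero' := Adj.ext_op fun x => by simp
  map_add' S T := Adj.ext_op fun x => by simp
  map_mul' S T := Adj.ext_op fun x => by simp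
  map_star' T := (Adj.star_eq_of_rip fun x y => by
    obtain ⟨x, rfl⟩ : ∃ z, X.act s z = x := ⟨_, X.act_act_inv s x⟩
    simp [X.rip_act_left, Adj.rip_op_star]).symm

@[simp] theorem op_conj (s : G) (T : Adj X.toRightHilbertBimodule) (x : X.carrier) :
    (X.conj s T).op x = X.act s (T.op (X.act s⁻¹ x)) := rfl

theorem conj_mul (s t : G) (T : Adj X.toRightHilbertBimodule) :
    X.conj (s * t) T = X.conj s (X.conj t T) :=
  Adj.ext_op fun x => by simp

theorem conj_one (T : Adj X.toRightHilbertBimodule) : X.conj 1 T = T :=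
  Adj.ext_op fun x => by simp

theorem conj_conj_inv (s : G) (T : Adj X.toRightHilbertBimodule) :
    X.conj s (X.conj s⁻¹ T) = T := by
  rw [← conj_mul, mul_inv_cancel, conj_one]

theorem conj_inv_conj (s : G) (T : Adj X.toRightHilbertBimodule) :
    X.conj s⁻¹ (X.conj s T) = T := by
  rw [← conj_mul, inv_mul_cancel, conj_one]

theorem conj_rankOne (s : G) (x y : X.carrier) :
    X.conj s (X.rankOne x y) = X.rankOne (X.act s x) (X.act s y) :=
  Adj.ext_op fun z => by simp [X.act_rsmul, X.rip_act_left]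

theorem conj_toAdj (s : G) (a : A.alg) : X.conj s (X.toAdj a) = X.toAdj (A.act s a) :=
  Adj.ext_op fun x => by simp [X.act_lsmul]

/-- Conjugation by `γ_s` as a continuous linear map. -/
noncomputable def conjL (s : G) :
    Adj X.toRightHilbertBimodule →L[ℂ] Adj X.toRightHilbertBimodule :=
  LinearMap.mkContinuous
    { toFun := X.conj s
      map_add' := map_add (X.conj s)
      map_smul' := map_smul (X.conj s) } 1 fun T => by
    rw [one_mul]
    exact NonUnitalStarAlgHom.norm_apply_le (X.conj s) T

theorem conj_mem_compacts (s : G) {T : Adj X.toRightHilbertBimodule}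
    (hT : T ∈ X.compactSubmodule) : X.conj s T ∈ X.compactSubmodule :=
  map_mem_compactSubmodule (X.conjL s) (fun x y => by
    change X.conj s (X.rankOne x y) ∈ _
    rw [conj_rankOne]
    exact X.rankOne_mem _ _) hT

/-- Conjugation by `γ_s` as an automorphism of the algebra of compact operators. -/
noncomputable def conjCompacts (s : G) : X.compacts ≃⋆ₐ[ℂ] X.compacts where
  toFun T := ⟨X.conj s T, X.conj_mem_compacts s T.2⟩
  invFun T := ⟨X.conj s⁻¹ T, X.conj_mem_compacts s⁻¹ T.2⟩
  left_inv T := Subtype.ext (X.conj_inv_conj s T)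
  right_inv T := Subtype.ext (X.conj_conj_inv s T)
  map_mul' S T := Subtype.ext (map_mul (X.conj s) S.1 T.1)
  map_add' S T := Subtype.ext (map_add (X.conj s) S.1 T.1)
  map_star' T := Subtype.ext (map_star (X.conj s) T.1)
  map_smul' c T := Subtype.ext (map_smul (X.conj s) c T.1)

/-- The C*-algebra of compact operators on `X` with the conjugation action of `G`. -/
noncomputable def compactSystem : CStarSystem.{u} G where
  alg := X.compacts
  act :=
    { toFun := X.conjCompacts
      map_one' := StarAlgEquiv.ext fun T => Subtype.ext (X.conj_one T)
      map_mul' := fun s t => StarAlgEquiv.ext fun T => Subtype.ext (X.conj_mul s t T) }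
  continuous_act T := by
    refine Continuous.subtype_mk (continuous_orbit_of_mem_closure_span
      (fun s => (X.conjL s).toLinearMap)
      (fun s T => NonUnitalStarAlgHom.norm_apply_le (X.conj s) T) ?_ T.2) _
    rintro _ ⟨x, y, rfl⟩
    change Continuous fun s => X.conj s (X.rankOne x y)
    simp only [conj_rankOne]
    exact X.continuous_rankOne.comp ((X.continuous_act x).prodMk (X.continuous_act y))

/-- `X` as a bimodule over its compact operators and `B`. -/
noncomputable def compactBimodule : EquivariantBimodule X.compactSystem B where
  carrier := X.carrier
  rsmul := X.rsmul
  lsmul := LinearMap.mk₂ ℂ (fun (T : X.compacts) x => T.1.op x) (fun _ _ _ => rfl)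
    (fun _ _ _ => rfl) (fun T x y => map_add T.1.op x y) (fun c T x => map_smul T.1.op c x)
  rip := X.rip
  rsmul_mul := X.rsmul_mul
  rip_rsmul := X.rip_rsmul
  star_rip := X.star_rip
  rip_self_nonneg := X.rip_self_nonneg
  norm_sq := X.norm_sq
  full := X.full
  mul_lsmul _ _ _ := rfl
  lsmul_rsmul T x b := X.ext_rip fun z => by
    change X.rip z (T.1.op (X.rsmul x b)) = X.rip z (X.rsmul (T.1.op x) b)
    rw [X.rip_rsmul, ← Adj.rip_adj, ← Adj.rip_adj, X.rip_rsmul]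
  rip_lsmul T x y := T.1.rip_op x y
  nondegenerate := by
    -- the vectors `x · ⟨y, z⟩ = θ_{x,y} z` are total in `X`
    refine X.dense_span_rsmul.span_of_subset_closure ?_
    rintro _ ⟨x, b, rfl⟩
    refine mem_of_dense_span X.full (X.rsmulL x) (Submodule.isClosed_topologicalClosure _) ?_ b
    rintro _ ⟨y, z, rfl⟩
    exact Submodule.le_topologicalClosure _
      (Submodule.subset_span ⟨X.compactRankOne x y, z, rfl⟩)
  act := X.act
  act_lsmul s T x := by
    change X.act s (T.1.op x) = (X.conj s T.1).op (X.act s x)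
    rw [op_conj, X.act_inv_act]
  act_rsmul := X.act_rsmul
  rip_act := X.rip_act
  continuous_act := X.continuous_act

theorem isEquivariantImprimitivity_compactBimodule :
    X.compactBimodule.IsEquivariantImprimitivity :=
  isEquivariantImprimitivity_of_lsmul_eq
    (fun (_ : X.compacts) h => Subtype.ext (Adj.ext_op h))
    X.compactRankOne (fun _ _ _ => rfl) X.dense_span_compactRankOne

/-- The left action of `A` on `X`, as a homomorphism of `A` into the multipliers of the compact
operators. -/
noncomputable def toCompactMultiplier : EquivariantMultiplierHom A X.compactSystem where
  hom := X.toMultiplierHom.comp X.toAdj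
  nondegenerate := by
    -- `a θ_{x,y} = θ_{a·x,y}`, and `A · X` is total in `X`
    refine Dense.span_of_subset_closure (V := X.compacts) X.dense_span_compactRankOne ?_
    rintro _ ⟨x, y, rfl⟩
    have h := mem_of_dense_span X.nondegenerate
      (⟨{ toFun := fun x => X.compactRankOne x y
          map_add' := fun x x' => Subtype.ext (map_add (X.rankOne.flip y) x x')
          map_smul' := fun c x => Subtype.ext (map_smul (X.rankOne.flip y) c x) },
        X.continuous_compactRankOne_left y⟩ : X.carrier →L[ℂ] X.compacts)
      (M := (Submodule.span ℂ {T : X.compacts | ∃ (a : A.alg) (S : X.compacts),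
        (X.toMultiplier (X.toAdj a)).fst S = T}).topologicalClosure)
      (Submodule.isClosed_topologicalClosure _) ?_ x
    · exact h
    · rintro _ ⟨a, x, rfl⟩
      refine Submodule.le_topologicalClosure _ (Submodule.subset_span
        ⟨a, X.compactRankOne x y, Subtype.ext ?_⟩)
      exact X.mul_rankOne (X.toAdj a) x y
  equivariant s a := by
    refine multiplier_ext (fun T => ?_) (fun T => ?_)
    · change X.toAdj (A.act s a) * T.1 = X.conj s (X.toAdj a * X.conj s⁻¹ T.1)
      rw [map_mul, conj_toAdj, conj_conj_inv]
    · change T.1 * X.toAdj (A.act s a) = X.conj s (X.conj s⁻¹ T.1 * X.toAdj a)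
      rw [map_mul, conj_toAdj, conj_conj_inv]

/-- `K(X) ⊗_{K(X)} X ≅ X`, with the left action of `A` on `K(X)` by multipliers. -/
theorem isBalancedTensor_compactBimodule :
    X.toCompactMultiplier.bimodule.IsBalancedTensor X.compactBimodule X := by
  refine (IsBalancedTensorMap.mk (q := TensorProduct.lift X.compactBimodule.lsmul)
    ?_ ?_ ?_ ?_).isBalancedTensor
  · have : ((Submodule.span ℂ {z : X.carrier | ∃ a x, X.compactBimodule.lsmul a x = z} :
        Submodule ℂ X.carrier) : Set X.carrier) ⊆
        (LinearMap.range (TensorProduct.lift X.compactBimodule.lsmul) :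
          Submodule ℂ X.carrier) := by
      refine Submodule.span_le.2 ?_
      rintro _ ⟨T, x, rfl⟩
      exact ⟨T ⊗ₜ x, rfl⟩
    exact X.compactBimodule.nondegenerate.mono this
  · intro (S : X.compacts) (x : X.carrier) (T : X.compacts) (y : X.carrier)
    change X.rip (S.1.op x) (T.1.op y) = X.rip x ((star S.1).op (T.1.op y))
    rw [Adj.rip_op_star]
  · intro a (T : X.compacts) x
    rfl
  · intro s (T : X.compacts) (x : X.carrier)
    change X.act s (T.1.op x) = (X.conj s T.1).op (X.act s x)
    rw [op_conj, X.act_inv_act]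

end EquivariantBimodule

/-! ### Isomorphisms and factorization -/

/-- The converse of `IsBalancedTensor.comp_cls`: being a balanced tensor product is invariant under
isomorphism. -/
theorem EquivariantBimodule.isBalancedTensor_of_comp_cls {G : Type v} [Group G]
    [TopologicalSpace G] {A B C : CStarSystem.{u} G} {X : EquivariantBimodule A B}
    {Y : EquivariantBimodule B C} {Z : EquivariantBimodule A C} (h : X.cls.comp Y.cls = Z.cls) :
    X.IsBalancedTensor Y Z := by
  obtain ⟨W, hW⟩ := exists_isBalancedTensor X Y
  obtain ⟨q, hq⟩ := hW.exists_map
  obtain ⟨Φ, h1, -, h3, h4⟩ := cls_eq_iff.1 (hW.comp_cls.symm.trans h)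
  have hΦ : Isometry Φ := AddMonoidHomClass.isometry_of_norm Φ fun x =>
    (sq_eq_sq₀ (norm_nonneg _) (norm_nonneg _)).1 (by rw [W.norm_sq, Z.norm_sq, h3])
  exact (IsBalancedTensorMap.mk (q := Φ.toLinearMap ∘ₗ q)
    (Φ.surjective.denseRange.comp hq.denseRange hΦ.continuous)
    (fun x y z w => by simp [h3, hq.rip_map])
    (fun a x y => by simp [← h1, hq.lsmul_map])
    (fun s x y => by simp [← h4, hq.act_map])).isBalancedTensor

/-- `IsIso.mk` with the category structure found by unification, for structures which are not
available as instances. -/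
theorem isIso_of_exists_inverse {D : Type*} {_ : Category D} {P Q : D} {f : P ⟶ Q}
    (h : ∃ g : Q ⟶ P, f ≫ g = 𝟙 P ∧ g ≫ f = 𝟙 Q) : IsIso f := ⟨h⟩

theorem proposition3p2 (G : Type v) [Group G] [TopologicalSpace G] [IsTopologicalGroup G]
    [LocallyCompactSpace G] :
    -- the tensor product of any two composable bimodules with compatible actions exists
    (∀ (A B C : CStarSystem.{u} G) (X : EquivariantBimodule A B) (Y : EquivariantBimodule B C),
      ∃ Z : EquivariantBimodule A C, X.IsBalancedTensor Y Z) ∧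
    -- it induces a composition, which together with the classes `[A, α]` gives a category
    ∃ (comp : ∀ {A B C : CStarSystem.{u} G},
        BimoduleClass A B → BimoduleClass B C → BimoduleClass A C)
      (id_comp : ∀ {A B : CStarSystem.{u} G} (f : BimoduleClass A B),
        comp A.idBimodule.cls f = f)
      (comp_id : ∀ {A B : CStarSystem.{u} G} (f : BimoduleClass A B),
        comp f B.idBimodule.cls = f)
      (assoc : ∀ {A B C D : CStarSystem.{u} G} (f : BimoduleClass A B) (g : BimoduleClass B C)
        (h : BimoduleClass C D), comp (comp f g) h = comp f (comp g h)),
      letI : Category.{max (u + 1) v} (CStarSystem.{u} G) :=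
        { Hom := BimoduleClass
          id := fun A => A.idBimodule.cls
          comp := comp
          id_comp := id_comp
          comp_id := comp_id
          assoc := assoc }
      -- the composition of `[X, γ]` with `[Y, η]` is the class of the tensor product action
      (∀ (A B C : CStarSystem.{u} G) (X : EquivariantBimodule A B) (Y : EquivariantBimodule B C)
        (Z : EquivariantBimodule A C), X.IsBalancedTensor Y Z →
          comp X.cls Y.cls = Z.cls) ∧
      -- the isomorphisms are exactly the classes of equivariant imprimitivity bimodules
      (∀ (A B : CStarSystem.{u} G) (X : EquivariantBimodule A B),
        @IsIso (CStarSystem.{u} G) _ A B X.cls ↔ X.IsEquivariantImprimitivity) ∧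
      -- factorization `[X, γ] = [Y, η] ∘ [φ, ε]`
      (∀ (A B : CStarSystem.{u} G) (X : EquivariantBimodule A B),
        ∃ (C : CStarSystem.{u} G) (Y : EquivariantBimodule C B)
          (φ : EquivariantMultiplierHom A C),
          @IsIso (CStarSystem.{u} G) _ C B Y.cls ∧
          X.cls = comp φ.bimodule.cls Y.cls) := by
  refine ⟨fun A B C X Y => EquivariantBimodule.exists_isBalancedTensor X Y, BimoduleClass.comp,
    BimoduleClass.id_comp, BimoduleClass.comp_id, BimoduleClass.assoc,
    fun A B C X Y Z h => h.comp_cls,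
    fun A B X => ⟨?_, fun h => ?_⟩, fun A B X => ?_⟩
  · rintro ⟨g, h1, h2⟩
    induction g using Quotient.inductionOn with
    | h Y =>
      exact EquivariantBimodule.isEquivariantImprimitivity_of_isBalancedTensor_id
        (EquivariantBimodule.isBalancedTensor_of_comp_cls h1)
        (EquivariantBimodule.isFaithful_of_isBalancedTensor_id
          (EquivariantBimodule.isBalancedTensor_of_comp_cls h2))
  · obtain ⟨Y, h1, h2⟩ := h.exists_inverse
    exact isIso_of_exists_inverse ⟨Y.cls, h1, h2⟩
  · obtain ⟨Y, h1, h2⟩ := X.isEquivariantImprimitivity_compactBimodule.exists_inverse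
    exact ⟨X.compactSystem, X.compactBimodule, X.toCompactMultiplier,
      isIso_of_exists_inverse ⟨Y.cls, h1, h2⟩,
      X.isBalancedTensor_compactBimodule.comp_cls.symm⟩
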